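/- Let $\gamma>0$, $\alpha>0$, $\kappa\ge 0$, $p\in\mathbb N$, let $\Omega$ be a Polish space with its Borel $\sigma$-field, and let $\Lambda_0$ be a probability measure on $\Omega$ without atoms (that is, $\Lambda_0(\{\omega\})=0$ for every $\omega$) with density $\lambda_0$ with respect to a $\sigma$-finite measure $\nu$. Write $B(a,b)$ for the beta function and $$\bar B^{a,b}:=\frac{B(\alpha+a,\kappa+1+b)}{B(\alpha,\kappa+1)}.$$ For a measure $\Lambda$ on $(0,\infty)\times\Omega$, a random measure $\mu$ on $\Omega$ is called $\mathrm{CRM}(\Lambda)$ if it has the law of $\sum_{(q,\omega)\in\Phi}q\,\delta_\omega$, where $\Phi$ is a Poisson point process with intensity $\Lambda$. For a purely atomic measure $m=\sum_k q_k\delta_{\omega_k}$ with distinct $\omega_k$ and $q_k\in[0,1]$, the Bernoulli process $\mathrm{BeP}(m)$ is the law of $\sum_k b_k\delta_{\omega_k}$ with independent $b_k\sim\mathrm{Bernoulli}(q_k)$. Let $\mu$ be $\mathrm{CRM}(\Lambda)$ with $$\Lambda(dq,d\omega)=\frac{\gamma}{B(\alpha,\kappa+1)}\,q^{\alpha-1}(1-q)^{\kappa}\,dq\,\Lambda_0(d\omega)\quad\text{on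 }(0,1]\times\Omega,$$ and, conditionally on $\mu$, let $\xi_1,\dots,\xi_p$ be iid with law $\mathrm{BeP}(\mu)$. (1) The joint law of $(\xi_1,\dots,\xi_p)$ has density $$e^{-\gamma\sum_{j=1}^p\bar B^{1,j-1}}\prod_{k=1}^{K^+}\gamma\,\bar B^{m_k,\,p-m_k}\,\lambda_0(\omega_k^*),$$ where $\omega_1^*,\dots,\omega_{K^+}^*$ are the atoms carried by at least one $\xi_j$ and $m_k=\sum_{j}\xi_j(\{\omega_k^*\})\ge 1$. Precisely, with $\Delta_1=\{0,1\}^p\setminus\{\mathbf 0\}$ and $|u|$ the number of ones of $u$, for every measurable $F\ge 0$, $$\mathsf E\,F(\xi_1,\dots,\xi_p)=\sum_{K=0}^\infty\frac1{K!}\sum_{u_1,\dots,u_K\in\Delta_1}\int_{\Omega^K}F\Big(\Big(\sum_{k=1}^K u_{jk}\,\delta_{\omega_k}\Big)_{j\le p}\Big)\,e^{-\gamma\sum_{j=1}^p\bar B^{1,j-1}}\prod_{k=1}^K\gamma\,\bar B^{|u_k|,\,p-|u_k|}\lambda_0(\omega_k)\;\nu(d\omega_1)\cdots\nu(d\omega_K),$$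 where $u_{jk}$ is the $j$-th entry of $u_k$. (2) Consequently the random-measure representation agrees with the hierarchical and the restaurant representation, up to permutation of columns and removal of zero columns. That is, for $u\in\Delta_1$ let $K_u$ be the number of $\omega\in\Omega$ with $(\xi_1(\{\omega\}),\dots,\xi_p(\{\omega\}))=u$. Then $(K_u)_{u\in\Delta_1}$ has the same law as the numbers of columns equal to $u$, $u\in\Delta_1$, in each of the following two random binary matrices with $p$ rows. * Hierarchical: $K\sim\mathrm{Poisson}(\gamma)$; given $K$, $\theta_1,\dots,\theta_K$ are iid $\mathrm{Beta}(\alpha,\kappa+1)$; given these, the entries $\xi_{jk}\sim\mathrm{Bernoulli}(\theta_k)$, $j\le p$, $k\le K$, are independent. * Restaurant: customers (rows) $j=1,\dots,p$ arrive in turn; customer $j$ tries each previously tasted dish (column) $k$ independently with probability $\frac{m_{j,k}+\alpha}{j+\kappa+\alpha}$, where $m_{j,k}$ is the number of earlier customers who tried it, and independently tries $\mathrm{Poisson}\big(\gamma B(\alpha+1,\kappa+j)/B(\alpha,\kappa+1)\big)$ new dishes. -/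

import Mathlib

open MeasureTheory ProbabilityTheory
open scoped ENNReal NNReal

noncomputable section

namespace CIBP

/-! ### Completely random measures -/

/-- `Q` is the law of a Poisson point process on `E` with intensity measure `Λ`: the random measure
distributed as `Q` has Poisson counts of mean `Λ B` on every measurable `B` of finite intensity, and
independent counts on disjoint measurable sets. -/
structure IsPoissonProcessLaw {E : Type*} [MeasurableSpace E]
    (Q : Measure (Measure E)) (Λ : Measure E) : Prop where
  isProbabilityMeasure : IsProbabilityMeasure Q
  law_count : ∀ B : Set E, MeasurableSet B → Λ B ≠ ∞ →
    Q.map (fun Φ : Measure E => Φ B)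
      = (poissonMeasure (Λ B).toNNReal).map (fun n : ℕ => (n : ℝ≥0∞))
  indep_count : ∀ (n : ℕ) (B : Fin n → Set E), (∀ i, MeasurableSet (B i)) →
    Pairwise (fun i j => Disjoint (B i) (B j)) →
    iIndepFun (fun (i : Fin n) (Φ : Measure E) => Φ (B i)) Q

/-- The measure `∑_{(q, ω) ∈ Φ} q δ_ω` attached to a counting measure `Φ` on `ℝ × Ω`, that is,
`A ↦ ∫_{ℝ × A} q Φ(dq, dω)`. -/
def weightedSum {Ω : Type*} [MeasurableSpace Ω] (Φ : Measure (ℝ × Ω)) : Measure Ω :=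
  (Φ.withDensity fun z => ENNReal.ofReal z.1).map Prod.snd

/-- The random measure `μ` is a (purely atomic) completely random measure `CRM(Λ)` without fixed
atoms: it is distributed as `∑_{(q, ω) ∈ Φ} q δ_ω`, where `Φ` is a Poisson process with
intensity `Λ`. -/
def IsCRM {S Ω : Type*} [MeasurableSpace S] [MeasurableSpace Ω]
    (P : Measure S) (μ : S → Measure Ω) (Λ : Measure (ℝ × Ω)) : Prop :=
  Measurable μ ∧ ∃ Q : Measure (Measure (ℝ × Ω)),
    IsPoissonProcessLaw Q Λ ∧ P.map μ = Q.map weightedSum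

/-- The Bernoulli law on `Bool` with success probability `r` (clamped to `[0, 1]`). -/
def bern (r : ℝ) : Measure Bool :=
  bernoulliMeasure true false (Set.projIcc (0 : ℝ) 1 zero_le_one r)

instance (r : ℝ) : IsProbabilityMeasure (bern r) := by
  unfold bern; infer_instance

/-- The law `BeP(m)` of the Bernoulli process with mean `m`, for a purely atomic measure
`m = ∑ q_k δ_{ω_k}` with distinct `ω_k`: the law of `∑ b_k δ_{ω_k}` with independent
`b_k ∼ Bernoulli(q_k)`. -/
def bernoulliProcess {Ω : Type*} [MeasurableSpace Ω] (m : Measure Ω) : Measure (Measure Ω) :=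
  (Measure.infinitePi fun ω : {ω : Ω // m {ω} ≠ 0} => bern (m {ω.1}).toReal).map
    fun b => Measure.sum fun ω : {ω : Ω // m {ω} ≠ 0} =>
      if b ω = true then Measure.dirac ω.1 else 0

/-- Conditionally on the random measure `μ`, the random measures `ξ₁, …, ξ_p` are independent and
identically distributed with law `BeP(μ)`. -/
def IsCondIIDBernoulli {S Ω : Type*} [MeasurableSpace S] [MeasurableSpace Ω] {p : ℕ}
    (P : Measure S) (ξ : Fin p → S → Measure Ω) (μ : S → Measure Ω) : Prop :=
  (∀ j, Measurable (ξ j)) ∧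
  P.map (fun s => (μ s, fun j => ξ j s)) =
    (P.map μ).bind fun m =>
      (Measure.pi fun _ : Fin p => bernoulliProcess m).map (Prod.mk m)

/-- The Lévy intensity `γ / B(α, κ+1) · q^(α-1) (1-q)^κ dq Λ₀(dω)` on `(0, 1] × Ω`. -/
def levyIntensity {Ω : Type*} [MeasurableSpace Ω] (γ α κ : ℝ) (Λ₀ : Measure Ω) :
    Measure (ℝ × Ω) :=
  ((volume.restrict (Set.Ioc (0 : ℝ) 1)).withDensity fun q =>
    ENNReal.ofReal (γ / beta α (κ + 1) * q ^ (α - 1) * (1 - q) ^ κ)).prod Λ₀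

/-! ### The joint density -/

/-- The ratio `B(a₁ + a₂, b₁ + b₂) / B(a₁, b₁)` of beta functions. -/
def betaRatio (a₁ b₁ a₂ b₂ : ℝ) : ℝ := beta (a₁ + a₂) (b₁ + b₂) / beta a₁ b₁

/-- Nonzero binary columns of length `p`. -/
abbrev NonzeroCol (p : ℕ) : Type := {u : Fin p → Bool // u ≠ fun _ => false}

/-- The number of ones in a binary vector. -/
def numOnes {p : ℕ} (u : Fin p → Bool) : ℕ := (Finset.univ.filter fun j => u j = true).card

/-- The rows `ξ_j = ∑_k u_{jk} δ_{ω_k}` with atoms `ω_1, …, ω_K` and binary columns `u_1, …, u_K`. -/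
def rowsOf {Ω : Type*} [MeasurableSpace Ω] {p K : ℕ} (u : Fin K → NonzeroCol p) (ω : Fin K → Ω) :
    Fin p → Measure Ω :=
  fun j => ∑ k, if (u k).1 j = true then Measure.dirac (ω k) else 0

/-- The CIBP density
`e^{-γ ∑_{j=1}^p B̄^{1,j-1}} ∏_{k=1}^K γ B̄^{m_k, p-m_k} λ₀(ω_k)` of a configuration with atoms
`ω_1, …, ω_K` and columns `u_1, …, u_K`, where `m_k` is the number of ones in `u_k`. -/
def cibpDensity {Ω : Type*} {p K : ℕ} (γ α κ : ℝ) (lam0 : Ω → ℝ≥0∞)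
    (u : Fin K → NonzeroCol p) (ω : Fin K → Ω) : ℝ≥0∞ :=
  ENNReal.ofReal (Real.exp
      (-γ * ∑ j ∈ Finset.Icc 1 p, betaRatio α (κ + 1) 1 ((j : ℝ) - 1))) *
    ∏ k, (ENNReal.ofReal
      (γ * betaRatio α (κ + 1) (numOnes (u k).1) ((p : ℝ) - numOnes (u k).1)) * lam0 (ω k))

/-- The law of `p` random measures whose density, relative to `ν`, at an (unordered) configuration
of atoms `ω_1, …, ω_K` with nonzero columns `u_1, …, u_K` is `cibpDensity`.  The factor `1 / K!`
accounts for the `K!` labellings of a configuration. -/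
def cibpLaw {Ω : Type*} [MeasurableSpace Ω] (p : ℕ) (γ α κ : ℝ) (ν : Measure Ω)
    (lam0 : Ω → ℝ≥0∞) : Measure (Fin p → Measure Ω) :=
  Measure.sum fun K : ℕ => ((K.factorial : ℝ≥0∞))⁻¹ •
    ∑ u : Fin K → NonzeroCol p,
      ((Measure.pi fun _ : Fin K => ν).withDensity (cibpDensity γ α κ lam0 u)).map (rowsOf u)

/-! ### Equivalence classes of binary matrices up to permutation of columns

A binary matrix with `p` rows and finitely many nonzero columns is determined, up to permutation of
its columns, by the numbers `K_u` of columns equal to `u`, for nonzero binary vectors `u`. -/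

/-- `K_u` for the binary matrix whose columns are the values `(ξ_1{ω}, …, ξ_p{ω})`, `ω ∈ Ω`. -/
def atomCount {Ω : Type*} [MeasurableSpace Ω] {p : ℕ} (x : Fin p → Measure Ω)
    (u : NonzeroCol p) : ℕ∞ :=
  Set.encard {ω : Ω | ∀ j, x j {ω} = if u.1 j = true then 1 else 0}

/-- The law of `(K_u)_u` under the hierarchical representation: `K ∼ Poisson(γ)`, then
`θ_1, …, θ_K` iid `Beta(α, κ+1)`, then independent entries `ξ_{jk} ∼ Bernoulli(θ_k)`. -/
def hierarchicalLaw (p : ℕ) (γ α κ : ℝ) : Measure (NonzeroCol p → ℕ) :=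
  (poissonMeasure γ.toNNReal).bind fun K =>
    ((Measure.pi fun _ : Fin K => betaMeasure α (κ + 1)).bind fun θ =>
      Measure.pi fun k : Fin K => Measure.pi fun _ : Fin p => bern (θ k)).map
    fun (M : Fin K → Fin p → Bool) (u : NonzeroCol p) =>
      (Finset.univ.filter fun k => M k = u.1).card

/-- Customer `j + 1` independently tries each dish `c` tasted by the `j` previous customers, with
probability `(m + α) / (j + 1 + κ + α)`, where `m` previous customers tried the dish. -/
def tryOldDishes (α κ : ℝ) (j : ℕ) : List (Fin j → Bool) → PMF (List (Fin (j + 1) → Bool))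
  | [] => PMF.pure []
  | c :: cs =>
    (bern ((numOnes c + α) / (((j + 1 : ℕ) : ℝ) + κ + α))).toPMF.bind fun b =>
      (tryOldDishes α κ j cs).bind fun cs' => PMF.pure (Fin.snoc c b :: cs')

/-- The restaurant analogy: the law of the list of columns (dishes) after `j` customers. Customer
`j + 1` retries the old dishes and tries `Poisson(γ B(α+1, κ+j+1) / B(α, κ+1))` new dishes. -/
def restaurant (γ α κ : ℝ) : (j : ℕ) → PMF (List (Fin j → Bool))
  | 0 => PMF.pure []
  | j + 1 =>
    (restaurant γ α κ j).bind fun cs =>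
      (tryOldDishes α κ j cs).bind fun old =>
        (poissonMeasure
            (γ * beta (α + 1) (κ + ((j + 1 : ℕ) : ℝ)) / beta α (κ + 1)).toNNReal).toPMF.bind
          fun n => PMF.pure (old ++ List.replicate n (Fin.snoc (fun _ => false) true))

/-- The law of `(K_u)_u` under the restaurant analogy with `p` customers. -/
def restaurantLaw (p : ℕ) (γ α κ : ℝ) : PMF (NonzeroCol p → ℕ) :=
  (restaurant γ α κ p).map fun cs u => cs.count u.1

end CIBP

end

/-! Since $\int_0^1 q^{\alpha-1}(1-q)^\kappa\,dq = B(\alpha,\kappa+1)$, the intensity is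
$\gamma\cdot\mathrm{Beta}(\alpha,\kappa+1)\otimes\Lambda_0$, a finite measure. Hence $\mu$ has
$\mathrm{Poisson}(\gamma)$ many atoms, with independent beta weights and independent
$\Lambda_0$-distributed positions, almost surely distinct. Given $\mu$, an atom of weight $q$
receives the column $u\in\{0,1\}^p$ with probability $q^{|u|}(1-q)^{p-|u|}$, whose beta average is
$w_u=\bar B^{|u|,p-|u|}$. Poisson thinning then makes the $K_u$ independent $\mathrm{Poisson}(\gamma
w_u)$ variables, and the zero column leaves no trace. The normalizing exponent is $\sum_{u\ne
0}w_u=\sum_j\bar B^{1,j-1}$, by telescoping $B(a,b)=B(a+1,b)+B(a,b+1)$ (`colWeight_false_add`).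

The proof replaces thinning by transforms. With $L_u=\int\prod_{u_j=1}e^{-f_j}\,d\Lambda_0$, the
Laplace functionals of the rows (`lintegral_map_rows`) and of the explicit law (`lintegral_cibpLaw`)
both equal $\exp\gamma\big(\sum_{u\ne0}w_uL_u-\sum_{u\ne0}w_u\big)$, and `ext_of_laplace` turns this
into equality of laws.

For the counts, all three generating functions are $\exp\gamma\sum_{u\ne0}w_u(s_u-1)$. The
hierarchical one averages over beta weights without positions. The restaurant one is an induction on
customers: the retrial probability is $w_{(u,1)}/w_u$, and the rate of new dishes is $\gamma
w_{(0,\dots,0,1)}$. What remains is measurability: on finite configurations, atom counts are limits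
of counts over ever finer cells (`eventually_cellCount_eq`). -/

noncomputable section

namespace CIBP

/-! ### Laplace transforms determine finite measures -/

/-- The function `x ↦ e^{-x}` on `[0, ∞]`. -/
def expNeg (x : ℝ≥0∞) : ℝ≥0∞ := EReal.exp (-(x : EReal))

@[simp] lemma expNeg_zero : expNeg 0 = 1 := by simp [expNeg]

lemma expNeg_le_one (x : ℝ≥0∞) : expNeg x ≤ 1 := by
  rw [expNeg, EReal.exp_le_one_iff, EReal.neg_le_zero]
  exact EReal.coe_ennreal_nonneg x

lemma expNeg_ne_top (x : ℝ≥0∞) : expNeg x ≠ ∞ :=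
  ((expNeg_le_one x).trans_lt ENNReal.one_lt_top).ne

lemma continuous_expNeg : Continuous expNeg :=
  ENNReal.continuous_exp.comp (continuous_neg.comp continuous_coe_ennreal_ereal)

@[fun_prop] lemma measurable_expNeg : Measurable expNeg := continuous_expNeg.measurable

lemma expNeg_injective : Function.Injective expNeg := fun x y h => by
  have := EReal.exp_strictMono.injective h
  exact EReal.coe_ennreal_injective (neg_injective this)

lemma expNeg_add (x y : ℝ≥0∞) : expNeg (x + y) = expNeg x * expNeg y := by
  rw [expNeg, expNeg, expNeg, ← EReal.exp_add, EReal.coe_ennreal_add, EReal.neg_add, sub_eq_add_neg]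
    <;> simp

lemma expNeg_sum {ι : Type*} (s : Finset ι) (x : ι → ℝ≥0∞) :
    expNeg (∑ i ∈ s, x i) = ∏ i ∈ s, expNeg (x i) := by
  classical
  induction s using Finset.induction_on with
  | empty => simp
  | insert i s hi ih => rw [Finset.sum_insert hi, Finset.prod_insert hi, expNeg_add, ih]

lemma expNeg_nat_mul (n : ℕ) (x : ℝ≥0∞) : expNeg (n * x) = expNeg x ^ n := by
  induction n with
  | zero => simp
  | succ n ih => rw [Nat.cast_succ, add_mul, one_mul, expNeg_add, ih, pow_succ]

/-- The bounded continuous function `x ↦ e^{-x_i}` on `[0, ∞]^ι`. -/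
def expNegCoord {ι : Type*} (i : ι) : BoundedContinuousFunction (ι → ℝ≥0∞) ℝ :=
  BoundedContinuousFunction.ofNormedAddCommGroup (fun x => (expNeg (x i)).toReal)
    (ENNReal.continuousOn_toReal.comp_continuous
      (continuous_expNeg.comp (continuous_apply i)) fun x => expNeg_ne_top _) 1
    fun x => by
      rw [Real.norm_of_nonneg ENNReal.toReal_nonneg]
      exact ENNReal.toReal_mono ENNReal.one_ne_top (expNeg_le_one _)

/-- Finite measures on `[0, ∞]^ι` are determined by their Laplace transform at integer points. -/
theorem ext_of_laplace_pi {ι : Type*} [Fintype ι] {ρ₁ ρ₂ : Measure (ι → ℝ≥0∞)}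
    [IsFiniteMeasure ρ₁] [IsFiniteMeasure ρ₂]
    (h : ∀ k : ι → ℕ, ∫⁻ x, expNeg (∑ i, k i * x i) ∂ρ₁ = ∫⁻ x, expNeg (∑ i, k i * x i) ∂ρ₂) :
    ρ₁ = ρ₂ := by
  -- The algebra generated by the $e^{-x_i}$ separates points, because $x\mapsto e^{-x}$ is
  -- injective up to and including $\infty$. It is spanned by products of generators, which are
  -- exactly the functions $e^{-\sum k_ix_i}$ with natural $k_i$.
  let S : Set (BoundedContinuousFunction (ι → ℝ≥0∞) ℝ) := Set.range expNegCoord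
  refine ext_of_forall_mem_subalgebra_integral_eq_of_polish (𝕜 := ℝ)
    (A := StarAlgebra.adjoin ℝ S) ?_ ?_
  · intro x y hxy
    obtain ⟨i, hi⟩ := Function.ne_iff.mp hxy
    refine ⟨expNegCoord i, ⟨_, ⟨expNegCoord i, StarAlgebra.subset_adjoin ℝ S ⟨i, rfl⟩, rfl⟩, rfl⟩,
      fun heq => hi ?_⟩
    exact expNeg_injective ((ENNReal.toReal_eq_toReal_iff' (expNeg_ne_top _) (expNeg_ne_top _)).mp heq)
  · have hstar : ∀ g : BoundedContinuousFunction (ι → ℝ≥0∞) ℝ, star g = g := fun g => by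
      ext x; simp
    have hS : star S = S := by
      ext g; rw [Set.mem_star, hstar]
    intro g hg
    have hg' : g ∈ Algebra.adjoin ℝ S := by
      have : g ∈ (StarAlgebra.adjoin ℝ S).toSubalgebra := hg
      rwa [StarAlgebra.adjoin_toSubalgebra, hS, Set.union_self] at this
    have hg'' : g ∈ Submodule.span ℝ (Submonoid.closure S : Set _) := by
      rw [← Algebra.adjoin_eq_span]; exact hg'
    induction hg'' using Submodule.span_induction with
    | mem m hm =>
      have hk : ∃ k : ι → ℕ, ∀ x, m x = (expNeg (∑ i, k i * x i)).toReal := by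
        clear hg hg'
        induction hm using Submonoid.closure_induction with
        | mem m hm =>
          obtain ⟨i, rfl⟩ := hm
          classical
          refine ⟨Pi.single i 1, fun x => ?_⟩
          rw [Finset.sum_eq_single i (fun j _ hj => by simp [hj]) (by simp)]
          simp [expNegCoord]
        | one => exact ⟨0, fun x => by simp⟩
        | mul m₁ m₂ _ _ h₁ h₂ =>
          obtain ⟨k₁, hk₁⟩ := h₁
          obtain ⟨k₂, hk₂⟩ := h₂
          refine ⟨k₁ + k₂, fun x => ?_⟩
          rw [BoundedContinuousFunction.mul_apply, hk₁, hk₂, ← ENNReal.toReal_mul, ← expNeg_add,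
            ← Finset.sum_add_distrib]
          simp [add_mul]
      obtain ⟨k, hk⟩ := hk
      simp_rw [hk]
      have hmeas : Measurable fun x : ι → ℝ≥0∞ => expNeg (∑ i, k i * x i) := by fun_prop
      rw [integral_toReal hmeas.aemeasurable (ae_of_all _ fun x => (expNeg_ne_top _).lt_top),
        integral_toReal hmeas.aemeasurable (ae_of_all _ fun x => (expNeg_ne_top _).lt_top), h k]
    | zero => simp
    | add a b ha hb iha ihb =>
      rw [← Algebra.adjoin_eq_span] at ha hb
      have hle : Algebra.adjoin ℝ S ≤ (StarAlgebra.adjoin ℝ S).toSubalgebra := by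
        rw [StarAlgebra.adjoin_toSubalgebra, hS, Set.union_self]
      simp only [BoundedContinuousFunction.coe_add, Pi.add_apply]
      rw [integral_add (a.integrable _) (b.integrable _),
        integral_add (a.integrable _) (b.integrable _), iha (hle ha) ha, ihb (hle hb) hb]
    | smul c a ha iha =>
      rw [← Algebra.adjoin_eq_span] at ha
      have hle : Algebra.adjoin ℝ S ≤ (StarAlgebra.adjoin ℝ S).toSubalgebra := by
        rw [StarAlgebra.adjoin_toSubalgebra, hS, Set.union_self]
      simp only [BoundedContinuousFunction.coe_smul]
      rw [integral_smul, integral_smul, iha (hle ha) ha]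

/-- Finite measures on a space whose `σ`-algebra is generated by a family `g` of `[0, ∞]`-valued
functions are determined by the Laplace transforms of the finite subfamilies of `g`. -/
theorem ext_of_laplace {Y T : Type*} [mY : MeasurableSpace Y] (g : T → Y → ℝ≥0∞)
    (hg : mY = MeasurableSpace.comap (fun y t => g t y) MeasurableSpace.pi)
    {ρ₁ ρ₂ : Measure Y} [IsFiniteMeasure ρ₁] [IsFiniteMeasure ρ₂]
    (h : ∀ (I : Finset T) (k : T → ℕ), ∫⁻ y, expNeg (∑ t ∈ I, k t * g t y) ∂ρ₁ =
      ∫⁻ y, expNeg (∑ t ∈ I, k t * g t y) ∂ρ₂) : ρ₁ = ρ₂ := by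
  have hm : Measurable fun y t => g t y := fun s hs => by rw [hg]; exact ⟨s, hs, rfl⟩
  have hmap : ρ₁.map (fun y t => g t y) = ρ₂.map fun y t => g t y := by
    -- A finite measure on a product is determined by its finite-dimensional marginals, which
    -- reduces the claim to `ext_of_laplace_pi`.
    refine IsProjectiveLimit.unique (P := fun I => (ρ₁.map fun y t => g t y).map I.restrict)
      (fun I => rfl) fun I => ?_
    have hr : Measurable (I.restrict : (T → ℝ≥0∞) → (I → ℝ≥0∞)) := Finset.measurable_restrict I
    change (ρ₂.map _).map I.restrict = (ρ₁.map _).map I.restrict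
    rw [Measure.map_map hr hm, Measure.map_map hr hm]
    symm
    refine ext_of_laplace_pi fun k => ?_
    classical
    rw [lintegral_map (by fun_prop) (hr.comp hm), lintegral_map (by fun_prop) (hr.comp hm)]
    have := h I fun t => if ht : t ∈ I then k ⟨t, ht⟩ else 0
    have key : ∀ y, ∑ t ∈ I, ((if ht : t ∈ I then k ⟨t, ht⟩ else 0 : ℕ) : ℝ≥0∞) * g t y =
        ∑ i : I, (k i : ℝ≥0∞) * g i y := fun y => by
      rw [← Finset.sum_coe_sort]
      exact Finset.sum_congr rfl fun i _ => by simp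
    simp_rw [key] at this
    exact this
  ext s hs
  rw [hg] at hs
  obtain ⟨s, hs, rfl⟩ := hs
  rw [← Measure.map_apply hm hs, hmap, Measure.map_apply hm hs]

/-! ### Poisson sums and Poisson numbers of independent points -/

lemma tsum_inv_factorial_mul_pow {x : ℝ} (hx : 0 ≤ x) :
    ∑' n : ℕ, (n.factorial : ℝ≥0∞)⁻¹ * ENNReal.ofReal x ^ n = ENNReal.ofReal (Real.exp x) := by
  have hs : HasSum (fun n : ℕ => x ^ n / n.factorial) (Real.exp x) := by
    rw [Real.exp_eq_exp_ℝ]; exact NormedSpace.expSeries_div_hasSum_exp x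
  rw [← hs.tsum_eq, ENNReal.ofReal_tsum_of_nonneg (fun n => by positivity) hs.summable]
  refine tsum_congr fun n => ?_
  rw [div_eq_inv_mul, ENNReal.ofReal_mul (by positivity), ENNReal.ofReal_pow hx,
    ENNReal.ofReal_inv_of_pos (by positivity), ENNReal.ofReal_natCast]

lemma tsum_poisson_mul_pow (r : ℝ≥0) {s : ℝ} (hs : 0 ≤ s) :
    ∑' n : ℕ, ENNReal.ofReal (Real.exp (-r) * r ^ n / n.factorial) * ENNReal.ofReal s ^ n =
      ENNReal.ofReal (Real.exp (r * s - r)) := by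
  have h : ∀ n : ℕ, ENNReal.ofReal (Real.exp (-r) * r ^ n / n.factorial) * ENNReal.ofReal s ^ n =
      ENNReal.ofReal (Real.exp (-r)) *
        ((n.factorial : ℝ≥0∞)⁻¹ * ENNReal.ofReal (r * s) ^ n) := fun n => by
    rw [div_eq_mul_inv, ENNReal.ofReal_mul (by positivity), ENNReal.ofReal_mul (by positivity),
      ENNReal.ofReal_mul (by positivity), ENNReal.ofReal_inv_of_pos (by positivity),
      ENNReal.ofReal_natCast, mul_pow, ENNReal.ofReal_pow (by positivity)]
    ring
  simp_rw [h]
  rw [ENNReal.tsum_mul_left, tsum_inv_factorial_mul_pow (by positivity),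
    ← ENNReal.ofReal_mul (by positivity), ← Real.exp_add]
  congr 2; ring

lemma lintegral_poissonMeasure (r : ℝ≥0) (f : ℕ → ℝ≥0∞) :
    ∫⁻ n, f n ∂poissonMeasure r =
      ∑' n : ℕ, ENNReal.ofReal (Real.exp (-r) * r ^ n / n.factorial) * f n := by
  simp [poissonMeasure, lintegral_sum_measure]

/-- The integral of a product of functions of the single coordinates of a product measure. -/
lemma lintegral_pi_prod {ι : Type*} [Fintype ι] {X : ι → Type*} [∀ i, MeasurableSpace (X i)]
    (ρ : ∀ i, Measure (X i)) [∀ i, IsProbabilityMeasure (ρ i)] {f : ∀ i, X i → ℝ≥0∞}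
    (hf : ∀ i, Measurable (f i)) :
    ∫⁻ x, ∏ i, f i (x i) ∂Measure.pi ρ = ∏ i, ∫⁻ x, f i x ∂ρ i := by
  have h := lintegral_prod_eq_prod_lintegral_of_indepFun Finset.univ
    (fun i (x : ∀ i, X i) => f i (x i)) (iIndepFun_pi (μ := ρ) fun i => (hf i).aemeasurable)
    fun i => (hf i).comp (measurable_pi_apply i)
  rw [h]
  refine Finset.prod_congr rfl fun i _ => ?_
  rw [← lintegral_map (hf i) (measurable_pi_apply i), (measurePreserving_eval ρ i).map_eq]

/-- The law of `ψ_K(z_1, …, z_K)` for `K ∼ Poisson(r)` and independent `z_k ∼ M`. -/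
def poissonized {E Y : Type*} [MeasurableSpace E] [MeasurableSpace Y] (r : ℝ≥0) (M : Measure E)
    (ψ : ∀ K, (Fin K → E) → Y) : Measure Y :=
  Measure.sum fun K : ℕ => ENNReal.ofReal (Real.exp (-r) * r ^ K / K.factorial) •
    (Measure.pi fun _ : Fin K => M).map (ψ K)

section Poissonized

variable {E Y Z : Type*} [MeasurableSpace E] [MeasurableSpace Y] [MeasurableSpace Z]
  {r : ℝ≥0} {M : Measure E} {ψ : ∀ K, (Fin K → E) → Y}

lemma poissonized_map (hψ : ∀ K, Measurable (ψ K)) {g : Y → Z} (hg : Measurable g) :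
    (poissonized r M ψ).map g = poissonized r M fun K z => g (ψ K z) := by
  simp only [poissonized, Measure.map_sum hg.aemeasurable, Measure.map_smul,
    Measure.map_map hg (hψ _)]
  rfl

lemma isProbabilityMeasure_poissonized [IsProbabilityMeasure M] (hψ : ∀ K, Measurable (ψ K)) :
    IsProbabilityMeasure (poissonized r M ψ) where
  measure_univ := by
    rw [poissonized, Measure.sum_apply _ .univ]
    have := tsum_poisson_mul_pow r zero_le_one
    simp only [Measure.smul_apply, smul_eq_mul, Measure.map_apply (hψ _) .univ, Set.preimage_univ,
      measure_univ]
    simpa using this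

/-- The probability generating functional of a mixed binomial configuration. -/
lemma lintegral_poissonized [IsProbabilityMeasure M] (hr : r ≠ 0) (hψ : ∀ K, Measurable (ψ K))
    {G : Y → ℝ≥0∞} (hG : AEMeasurable G (poissonized r M ψ)) {h : E → ℝ≥0∞} (hh : Measurable h)
    (hfin : ∫⁻ z, h z ∂M ≠ ∞)
    (hGh : ∀ K, ∀ᵐ z ∂(Measure.pi fun _ : Fin K => M), G (ψ K z) = ∏ k, h (z k)) :
    ∫⁻ y, G y ∂poissonized r M ψ = ENNReal.ofReal (Real.exp (r * (∫⁻ z, h z ∂M).toReal - r)) := by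
  rw [poissonized, lintegral_sum_measure,
    ← tsum_poisson_mul_pow r ENNReal.toReal_nonneg, ENNReal.ofReal_toReal hfin]
  refine tsum_congr fun K => ?_
  have hpos : 0 < (r : ℝ) := by positivity
  -- Every $K$ has positive Poisson weight because $r\ne0$, so almost everywhere measurability under
  -- the mixture passes to each component.
  have hGK : AEMeasurable G ((Measure.pi fun _ : Fin K => M).map (ψ K)) := by
    have h1 := hG.mono_measure (Measure.le_sum _ K)
    rwa [aemeasurable_smul_measure_iff (by
      simpa using (by positivity : 0 < Real.exp (-(r : ℝ)) * r ^ K / K.factorial))] at h1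
  rw [lintegral_smul_measure, lintegral_map' hGK (hψ K).aemeasurable, lintegral_congr_ae (hGh K),
    lintegral_pi_prod _ fun _ => hh]
  simp

end Poissonized

/-! ### Poisson processes of finite intensity -/

/-- The counting measure of a finite list of points. -/
def sumDirac {E : Type*} [MeasurableSpace E] (K : ℕ) (z : Fin K → E) : Measure E :=
  ∑ k, Measure.dirac (z k)

lemma measurable_finset_sum_measure {E X ι : Type*} [MeasurableSpace E] [MeasurableSpace X]
    (s : Finset ι) {m : ι → X → Measure E} (hm : ∀ i ∈ s, Measurable (m i)) :
    Measurable fun x => ∑ i ∈ s, m i x := by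
  refine Measure.measurable_of_measurable_coe _ fun A hA => ?_
  simp only [Measure.coe_finsetSum, Finset.sum_apply]
  exact Finset.measurable_sum _ fun i hi => (Measure.measurable_coe hA).comp (hm i hi)

lemma measurable_sumDirac {E : Type*} [MeasurableSpace E] (K : ℕ) :
    Measurable (sumDirac (E := E) K) :=
  measurable_finset_sum_measure _ fun k _ => Measure.measurable_dirac.comp (measurable_pi_apply k)

/-- Finite laws of random measures are determined by their Laplace functionals. -/
theorem ext_of_laplace_measure {E : Type*} [MeasurableSpace E] {Q₁ Q₂ : Measure (Measure E)}
    [IsFiniteMeasure Q₁] [IsFiniteMeasure Q₂]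
    (h : ∀ f : SimpleFunc E ℝ≥0∞, ∫⁻ Φ, expNeg (∫⁻ x, f x ∂Φ) ∂Q₁ = ∫⁻ Φ, expNeg (∫⁻ x, f x ∂Φ) ∂Q₂) :
    Q₁ = Q₂ := by
  -- The evaluations $\Phi\mapsto\Phi(A)$ generate the $\sigma$-algebra, and a combination $\sum
  -- k_A\Phi(A)$ is the integral of a simple function.
  refine ext_of_laplace (T := {A : Set E // MeasurableSet A}) (fun A Φ => Φ A.1) ?_ fun I k => ?_
  · simp only [MeasurableSpace.pi, MeasurableSpace.comap_iSup, MeasurableSpace.comap_comp,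
      Measure.instMeasurableSpace, iSup_subtype]
    rfl
  · let f : SimpleFunc E ℝ≥0∞ := ∑ A ∈ I, SimpleFunc.piecewise A.1 A.2
      (SimpleFunc.const E (k A : ℝ≥0∞)) 0
    have hf : ∀ Φ : Measure E, ∫⁻ x, f x ∂Φ = ∑ A ∈ I, k A * Φ A.1 := fun Φ => by
      have : ∀ x, f x = ∑ A ∈ I, A.1.indicator (fun _ => (k A : ℝ≥0∞)) x := fun x => by
        have hs : ∀ (J : Finset {A : Set E // MeasurableSet A}) (g : _ → SimpleFunc E ℝ≥0∞),
            (∑ A ∈ J, g A) x = ∑ A ∈ J, g A x := fun J g => by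
          classical
          induction J using Finset.induction_on with
          | empty => simp
          | insert A J hA ih => simp [Finset.sum_insert hA, ih]
        rw [hs]
        refine Finset.sum_congr rfl fun A _ => ?_
        rw [SimpleFunc.coe_piecewise]
        rfl
      simp_rw [this]
      rw [lintegral_finsetSum _ fun A _ => measurable_const.indicator A.2]
      refine Finset.sum_congr rfl fun A _ => ?_
      rw [lintegral_indicator_const A.2]
    simpa only [hf] using h f

/-- A Poisson process with finite intensity is a Poisson number of independent points. -/
theorem IsPoissonProcessLaw.eq_poissonized {E : Type*} [MeasurableSpace E]
    {Q : Measure (Measure E)} {r : ℝ≥0} {M : Measure E} [IsProbabilityMeasure M] (hr : r ≠ 0)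
    (hQ : IsPoissonProcessLaw Q (r • M)) : Q = poissonized r M sumDirac := by
  have := hQ.isProbabilityMeasure
  have := isProbabilityMeasure_poissonized (r := r) (M := M) (measurable_sumDirac (E := E))
  refine ext_of_laplace_measure fun f => ?_
  have hle : ∫⁻ z, expNeg (f z) ∂M ≠ ∞ :=
    ((lintegral_mono fun z => expNeg_le_one (f z)).trans_lt (by simp)).ne
  have hmeas : Measurable fun Φ : Measure E => expNeg (∫⁻ x, f x ∂Φ) :=
    measurable_expNeg.comp (Measure.measurable_lintegral f.measurable)
  rw [lintegral_poissonized hr measurable_sumDirac hmeas.aemeasurable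
    (measurable_expNeg.comp f.measurable) hle fun K => ae_of_all _ fun z => by
      simp [sumDirac, expNeg_sum, lintegral_dirac' _ f.measurable]]
  have hB : ∀ v, MeasurableSet (f ⁻¹' {v}) := fun v => f.measurableSet_preimage _
  let e := f.range.equivFin
  -- The level sets of $f$ partition the space, so the counts on them are independent Poisson
  -- variables and the Laplace functional factors over the values $v$ of $f$. The factor at $v$ is
  -- $\exp\big(rM(f=v)(e^{-v}-1)\big)$; summing the exponents gives $r\big(\int e^{-f}dM-1\big)$.
  have hind := hQ.indep_count f.range.card (fun i => f ⁻¹' {(e.symm i).1}) (fun i => hB _)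
    fun i j hij => by
      refine Disjoint.preimage _ (Set.disjoint_singleton.mpr fun h => hij ?_)
      exact e.symm.injective (Subtype.ext h)
  have hcount : ∀ v, ∫⁻ Φ, expNeg (v * Φ (f ⁻¹' {v})) ∂Q =
      ENNReal.ofReal (Real.exp (r * ((expNeg v).toReal * (M (f ⁻¹' {v})).toReal) -
        r * (M (f ⁻¹' {v})).toReal)) := fun v => by
    have hΛ : (r • M) (f ⁻¹' {v}) ≠ ∞ := measure_ne_top _ _
    have hm : Measurable fun x : ℝ≥0∞ => expNeg (v * x) := by fun_prop
    rw [← lintegral_map hm (Measure.measurable_coe (hB v)), hQ.law_count _ (hB v) hΛ,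
      lintegral_map hm (by fun_prop)]
    simp_rw [mul_comm v, expNeg_nat_mul]
    rw [lintegral_poissonMeasure, ← ENNReal.ofReal_toReal (expNeg_ne_top v),
      tsum_poisson_mul_pow _ ENNReal.toReal_nonneg]
    have h1 : ((((r • M) (f ⁻¹' {v})).toNNReal : ℝ≥0) : ℝ) = r * (M (f ⁻¹' {v})).toReal := by
      rw [Measure.smul_apply, ENNReal.smul_def, smul_eq_mul, ENNReal.toNNReal_mul]
      simp [ENNReal.toReal]
    rw [h1, ENNReal.ofReal_toReal (expNeg_ne_top v)]
    congr 2; ring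
  have hsum : ∀ Φ : Measure E, expNeg (∫⁻ x, f x ∂Φ) =
      ∏ i ∈ Finset.univ, expNeg ((e.symm i).1 * Φ (f ⁻¹' {(e.symm i).1})) := fun Φ => by
    rw [← expNeg_sum, SimpleFunc.lintegral_eq_lintegral, SimpleFunc.lintegral,
      e.symm.sum_comp (fun v : f.range => (v : ℝ≥0∞) * Φ (f ⁻¹' {v.1})), Finset.sum_coe_sort
      f.range fun v => v * Φ (f ⁻¹' {v})]
  simp_rw [hsum]
  rw [lintegral_prod_eq_prod_lintegral_of_indepFun Finset.univ
    (fun i (Φ : Measure E) => expNeg ((e.symm i).1 * Φ (f ⁻¹' {(e.symm i).1})))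
    (hind.comp (fun i x => expNeg ((e.symm i).1 * x)) fun i => by fun_prop)
    fun i => measurable_expNeg.comp ((Measure.measurable_coe (hB _)).const_mul _)]
  simp_rw [hcount]
  rw [e.symm.prod_comp (fun v : f.range => ENNReal.ofReal (Real.exp
    (r * ((expNeg v).toReal * (M (f ⁻¹' {v.1})).toReal) - r * (M (f ⁻¹' {v.1})).toReal))),
    Finset.prod_coe_sort f.range fun v => ENNReal.ofReal (Real.exp
    (r * ((expNeg v).toReal * (M (f ⁻¹' {v})).toReal) - r * (M (f ⁻¹' {v})).toReal)),
    ← ENNReal.ofReal_prod_of_nonneg fun _ _ => (Real.exp_pos _).le, ← Real.exp_sum,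
    Finset.sum_sub_distrib, ← Finset.mul_sum, ← Finset.mul_sum]
  have h1 : ∑ v ∈ f.range, (M (f ⁻¹' {v})).toReal = 1 := by
    rw [← ENNReal.toReal_sum fun _ _ => measure_ne_top _ _, f.sum_range_measure_preimage_singleton]
    simp
  have h2 : ∑ v ∈ f.range, (expNeg v).toReal * (M (f ⁻¹' {v})).toReal =
      (∫⁻ z, expNeg (f z) ∂M).toReal := by
    have : ∫⁻ z, expNeg (f z) ∂M = ∑ v ∈ f.range, expNeg v * M (f ⁻¹' {v}) := by
      rw [← SimpleFunc.map_lintegral, ← SimpleFunc.lintegral_eq_lintegral]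
      rfl
    rw [this, ENNReal.toReal_sum fun _ _ =>
      ENNReal.mul_ne_top (expNeg_ne_top _) (measure_ne_top _ _)]
    simp
  rw [h1, h2, mul_one]
  rfl

/-! ### Beta functions and weights of columns -/

lemma beta_add_one_left {a b : ℝ} (ha : 0 < a) (hb : 0 < b) :
    beta (a + 1) b = beta a b * (a / (a + b)) := by
  have h : Real.Gamma (a + b) ≠ 0 := (Real.Gamma_pos_of_pos (add_pos ha hb)).ne'
  rw [beta, beta, Real.Gamma_add_one ha.ne', show a + 1 + b = a + b + 1 by ring,
    Real.Gamma_add_one (add_pos ha hb).ne']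
  field_simp

lemma beta_comm (a b : ℝ) : beta a b = beta b a := by
  rw [beta, beta, mul_comm, add_comm]

lemma beta_add_one_right {a b : ℝ} (ha : 0 < a) (hb : 0 < b) :
    beta a (b + 1) = beta a b * (b / (a + b)) := by
  rw [beta_comm, beta_add_one_left hb ha, beta_comm, add_comm b a]

/-- The weight `B(α + m, κ + 1 + p - m) / B(α, κ + 1)` of a binary column with `m` ones. -/
def colWeight {p : ℕ} (α κ : ℝ) (u : Fin p → Bool) : ℝ :=
  betaRatio α (κ + 1) (numOnes u) ((p : ℝ) - numOnes u)

lemma numOnes_le {p : ℕ} (u : Fin p → Bool) : numOnes u ≤ p :=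
  (Finset.card_filter_le _ _).trans_eq (by simp)

lemma numOnes_snoc {p : ℕ} (u : Fin p → Bool) (b : Bool) :
    numOnes (Fin.snoc u b : Fin (p + 1) → Bool) = numOnes u + if b = true then 1 else 0 := by
  rw [numOnes, numOnes, Finset.card_filter, Finset.card_filter, Fin.sum_univ_castSucc]
  simp

lemma numOnes_false {p : ℕ} : numOnes (fun _ : Fin p => false) = 0 := by
  simp [numOnes]

variable {α κ : ℝ}

lemma betaRatio_pos (hα : 0 < α) (hκ : 0 ≤ κ) {a b : ℝ} (ha : 0 ≤ a) (hb : 0 ≤ b) :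
    0 < betaRatio α (κ + 1) a b :=
  div_pos (beta_pos (by linarith) (by linarith)) (beta_pos hα (by linarith))

lemma colWeight_pos (hα : 0 < α) (hκ : 0 ≤ κ) {p : ℕ} (u : Fin p → Bool) : 0 < colWeight α κ u :=
  betaRatio_pos hα hκ (by positivity) (by
    have : (numOnes u : ℝ) ≤ p := by exact_mod_cast numOnes_le u
    linarith)

/-- This is the beta–Bernoulli predictive probability: after $p$ trials with $m$ successes the
posterior is $\mathrm{Beta}(\alpha+m,\kappa+1+p-m)$, whose mean is the restaurant's retrial
probability. -/
lemma colWeight_snoc_true (hα : 0 < α) (hκ : 0 ≤ κ) {p : ℕ} (u : Fin p → Bool) :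
    colWeight α κ (Fin.snoc u true : Fin (p + 1) → Bool) =
      colWeight α κ u * ((numOnes u + α) / (((p + 1 : ℕ) : ℝ) + κ + α)) := by
  have h : (numOnes u : ℝ) ≤ p := by exact_mod_cast numOnes_le u
  rw [colWeight, colWeight, betaRatio, betaRatio, numOnes_snoc]
  have := beta_add_one_left (a := α + numOnes u) (b := κ + 1 + (p - numOnes u))
    (by positivity) (by linarith)
  push_cast
  rw [show α + ((numOnes u : ℝ) + (if true = true then 1 else 0)) = α + numOnes u + 1 by simp; ring,
    show κ + 1 + ((p : ℝ) + 1 - (numOnes u + (if true = true then 1 else 0))) =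
      κ + 1 + (p - numOnes u) by simp, this,
    show α + (numOnes u : ℝ) + (κ + 1 + (p - numOnes u)) = p + 1 + κ + α by ring]
  ring

lemma colWeight_snoc_false (hα : 0 < α) (hκ : 0 ≤ κ) {p : ℕ} (u : Fin p → Bool) :
    colWeight α κ (Fin.snoc u false : Fin (p + 1) → Bool) =
      colWeight α κ u * (1 - (numOnes u + α) / (((p + 1 : ℕ) : ℝ) + κ + α)) := by
  have h : (numOnes u : ℝ) ≤ p := by exact_mod_cast numOnes_le u
  rw [colWeight, colWeight, betaRatio, betaRatio, numOnes_snoc]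
  have := beta_add_one_right (a := α + numOnes u) (b := κ + 1 + (p - numOnes u))
    (by positivity) (by linarith)
  have hp : (p : ℝ) + 1 + κ + α ≠ 0 := by positivity
  rw [Nat.cast_add, Nat.cast_ite, Nat.cast_one, Nat.cast_zero, Nat.cast_add, Nat.cast_one]
  rw [show α + ((numOnes u : ℝ) + (if false = true then 1 else 0)) = α + numOnes u by simp,
    show κ + 1 + ((p : ℝ) + 1 - (numOnes u + (if false = true then 1 else 0))) =
      κ + 1 + (p - numOnes u) + 1 by simp; ring, this,
    show α + (numOnes u : ℝ) + (κ + 1 + (p - numOnes u)) = p + 1 + κ + α by ring]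
  field_simp
  ring

lemma sum_snoc {p : ℕ} {A : Type*} [AddCommMonoid A] (g : (Fin (p + 1) → Bool) → A) :
    ∑ v, g v = ∑ u : Fin p → Bool, (g (Fin.snoc u true) + g (Fin.snoc u false)) := by
  rw [← (Fin.snocEquiv fun _ : Fin (p + 1) => Bool).sum_comp, Fintype.sum_prod_type, Fintype.sum_bool,
    ← Finset.sum_add_distrib]
  rfl

/-- The two predictive probabilities of the last entry add up to one. -/
lemma sum_colWeight (hα : 0 < α) (hκ : 0 ≤ κ) (p : ℕ) : ∑ u : Fin p → Bool, colWeight α κ u = 1 := by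
  induction p with
  | zero =>
    have h : beta α (κ + 1) ≠ 0 := (beta_pos hα (by linarith)).ne'
    simp [colWeight, betaRatio, numOnes, h]
  | succ p ih =>
    rw [sum_snoc, ← ih]
    refine Finset.sum_congr rfl fun u _ => ?_
    rw [colWeight_snoc_true hα hκ, colWeight_snoc_false hα hκ]
    ring

/-- The sum `∑_{j=1}^p B̄^{1,j-1}`. -/
def tastedMass (p : ℕ) (α κ : ℝ) : ℝ := ∑ j ∈ Finset.Icc 1 p, betaRatio α (κ + 1) 1 ((j : ℝ) - 1)

/-- Telescoping: by $B(\alpha,b)=B(\alpha,b+1)+B(\alpha+1,b)$ with $b=\kappa+1+p$, the weight of the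
zero column drops by $\bar B^{1,p}$ when row $p+1$ is added. -/
lemma colWeight_false_add (hα : 0 < α) (hκ : 0 ≤ κ) (p : ℕ) :
    colWeight α κ (fun _ : Fin p => false) + tastedMass p α κ = 1 := by
  induction p with
  | zero =>
    have h : beta α (κ + 1) ≠ 0 := (beta_pos hα (by linarith)).ne'
    simp [colWeight, betaRatio, numOnes, h, tastedMass]
  | succ p ih =>
    rw [← ih, tastedMass, Finset.sum_Icc_succ_top (by omega), ← tastedMass]
    have h1 := beta_add_one_right (a := α) (b := κ + 1 + p) hα (by positivity)
    have h2 := beta_add_one_left (a := α) (b := κ + 1 + p) hα (by positivity)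
    have h3 : α + (κ + 1 + p) ≠ 0 := by positivity
    have h4 : beta α (κ + 1) ≠ 0 := (beta_pos hα (by linarith)).ne'
    have h5 : colWeight α κ (fun _ : Fin (p + 1) => false) + betaRatio α (κ + 1) 1 p =
        colWeight α κ (fun _ : Fin p => false) := by
      simp only [colWeight, betaRatio, numOnes_false, Nat.cast_zero, add_zero, sub_zero]
      push_cast
      rw [← add_assoc (κ + 1), h1, h2]
      field_simp
      ring
    push_cast
    rw [add_sub_cancel_right]
    linarith

lemma sum_nonzeroCol {p : ℕ} {A : Type*} [AddCommMonoid A] (g : (Fin p → Bool) → A) :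
    ∑ u, g u = g (fun _ => false) + ∑ u : NonzeroCol p, g u.1 := by
  rw [← Fintype.sum_subtype_add_sum_subtype (fun u => u = fun _ => false) g]
  congr 1
  · have h : ∀ u : {u : Fin p → Bool // u = fun _ => false}, g u = g fun _ => false := fun u => by
      rw [u.2]
    simp [h]

lemma sum_nonzeroCol_colWeight (hα : 0 < α) (hκ : 0 ≤ κ) (p : ℕ) :
    ∑ u : NonzeroCol p, colWeight α κ u.1 = tastedMass p α κ := by
  have h1 := sum_colWeight hα hκ p
  have h2 := colWeight_false_add hα hκ p
  rw [sum_nonzeroCol] at h1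
  linarith

/-- The moments of the beta distribution. -/
lemma lintegral_pow_mul_pow_betaMeasure (hα : 0 < α) (hκ : 0 ≤ κ) (m n : ℕ) :
    ∫⁻ q, ENNReal.ofReal q ^ m * ENNReal.ofReal (1 - q) ^ n ∂betaMeasure α (κ + 1) =
      ENNReal.ofReal (betaRatio α (κ + 1) m n) := by
  have hm : Measurable fun q : ℝ => ENNReal.ofReal q ^ m * ENNReal.ofReal (1 - q) ^ n := by fun_prop
  have hpdf : ∀ a b : ℝ, Measurable (betaPDF a b) := fun a b =>
    (measurable_betaPDFReal a b).ennreal_ofReal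
  rw [betaMeasure, lintegral_withDensity_eq_lintegral_mul _ (hpdf _ _) hm]
  have hκ' : 0 < κ + 1 := by linarith
  have hb := beta_pos hα hκ'
  have ha' : 0 < α + m := by positivity
  have hκ'' : 0 < κ + 1 + n := by positivity
  have hb' := beta_pos ha' hκ''
  -- Conjugacy: the product is a multiple of another beta density, whose integral is $1$.
  have key : ∀ q, (betaPDF α (κ + 1) * fun q => ENNReal.ofReal q ^ m * ENNReal.ofReal (1 - q) ^ n) q =
      ENNReal.ofReal (betaRatio α (κ + 1) m n) * betaPDF (α + m) (κ + 1 + n) q := fun q => by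
    rw [Pi.mul_apply]
    by_cases hq : 0 < q ∧ q < 1
    · have hq' : 0 < 1 - q := by linarith [hq.2]
      rw [betaPDF_of_pos_lt_one hq.1 hq.2, betaPDF_of_pos_lt_one hq.1 hq.2,
        ← ENNReal.ofReal_pow hq.1.le, ← ENNReal.ofReal_pow hq'.le,
        ← ENNReal.ofReal_mul (pow_nonneg hq.1.le _), ← ENNReal.ofReal_mul
        (mul_nonneg (mul_nonneg (by positivity) (Real.rpow_nonneg hq.1.le _))
          (Real.rpow_nonneg hq'.le _)), ← ENNReal.ofReal_mul (by rw [betaRatio]; positivity),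
        betaRatio, show α + m - 1 = (α - 1) + m by ring,
        show κ + 1 + n - 1 = (κ + 1 - 1) + n by ring, Real.rpow_add hq.1, Real.rpow_add hq',
        Real.rpow_natCast, Real.rpow_natCast]
      congr 1
      field_simp
    · simp only [betaPDF_eq, if_neg hq]
      simp
  rw [lintegral_congr key, lintegral_const_mul _ (hpdf _ _), lintegral_betaPDF_eq_one ha' hκ'',
    mul_one]

lemma lintegral_colWeight (hα : 0 < α) (hκ : 0 ≤ κ) {p : ℕ} (u : Fin p → Bool) :
    ∫⁻ q, ∏ j, (if u j = true then ENNReal.ofReal q else ENNReal.ofReal (1 - q))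
      ∂betaMeasure α (κ + 1) = ENNReal.ofReal (colWeight α κ u) := by
  have h : ∀ q : ℝ, ∏ j, (if u j = true then ENNReal.ofReal q else ENNReal.ofReal (1 - q)) =
      ENNReal.ofReal q ^ numOnes u * ENNReal.ofReal (1 - q) ^ (p - numOnes u) := fun q => by
    rw [Finset.prod_ite, Finset.prod_const, Finset.prod_const, numOnes]
    congr 2
    have := Finset.card_filter_add_card_filter_not (s := Finset.univ) fun j : Fin p => u j = true
    rw [Finset.card_univ, Fintype.card_fin] at this
    omega
  simp_rw [h]
  rw [lintegral_pow_mul_pow_betaMeasure hα hκ, colWeight, Nat.cast_sub (numOnes_le u)]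

lemma ae_betaMeasure (a b : ℝ) : ∀ᵐ q ∂betaMeasure a b, 0 < q ∧ q < 1 := by
  have hpdf : Measurable (betaPDF a b) := (measurable_betaPDFReal a b).ennreal_ofReal
  rw [betaMeasure, ae_withDensity_iff hpdf]
  refine ae_of_all _ fun q hq => ?_
  by_contra h
  exact hq (by simp [betaPDF_eq, h])

/-- The normalization by $B(\alpha,\kappa+1)$ is that of the beta density, so the process is of
finite activity. -/
lemma levyIntensity_eq {Ω : Type*} [MeasurableSpace Ω] {γ : ℝ} (hγ : 0 < γ) (Λ₀ : Measure Ω)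
    [SFinite Λ₀] :
    levyIntensity γ α κ Λ₀ = γ.toNNReal • (betaMeasure α (κ + 1)).prod Λ₀ := by
  have hsmul : ∀ ρ : Measure (ℝ × Ω), γ.toNNReal • ρ = ENNReal.ofReal γ • ρ := fun ρ => rfl
  have hpdf : Measurable (betaPDF α (κ + 1)) := (measurable_betaPDFReal α (κ + 1)).ennreal_ofReal
  rw [levyIntensity, hsmul, ← Measure.prod_smul_left]
  congr 1
  rw [betaMeasure, ← withDensity_smul _ hpdf, ← withDensity_indicator measurableSet_Ioc]
  refine withDensity_congr_ae ?_
  -- The intensity lives on $(0,1]$ and the beta density on $(0,1)$; at the null point $q=1$ they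
  -- differ when $\kappa=0$.
  have h1 : ∀ᵐ q : ℝ, q ≠ 1 := by simp [ae_iff]
  filter_upwards [h1] with q hq
  by_cases h : 0 < q ∧ q < 1
  · rw [Set.indicator_of_mem (show q ∈ Set.Ioc 0 1 from ⟨h.1, h.2.le⟩), Pi.smul_apply,
      betaPDF_of_pos_lt_one h.1 h.2, smul_eq_mul, ← ENNReal.ofReal_mul hγ.le, add_sub_cancel_right]
    congr 1
    ring
  · rw [Set.indicator_of_notMem (fun hq' => h ⟨hq'.1, lt_of_le_of_ne hq'.2 hq⟩)]
    simp [betaPDF_eq, h]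

/-! ### Almost sure distinctness of atoms -/

/-- Two coordinates are independent with an atomless law, so by Tonelli the diagonal is null. The
map `g` selects the position from a pair of weight and position, or is the identity. -/
lemma ae_pi_injective {E Ω : Type*} [MeasurableSpace E] [MeasurableSpace Ω]
    [MeasurableEq Ω] (M : Measure E) [IsProbabilityMeasure M] {g : E → Ω} (hg : Measurable g)
    [NullSingletonClass (M.map g)] (K : ℕ) :
    ∀ᵐ z ∂(Measure.pi fun _ : Fin K => M), Function.Injective fun k => g (z k) := by
  have hgM : IsProbabilityMeasure (M.map g) := Measure.isProbabilityMeasure_map hg.aemeasurable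
  have hne : ∀ k l : Fin K, k ≠ l →
      ∀ᵐ z ∂(Measure.pi fun _ : Fin K => M), g (z k) ≠ g (z l) := fun k l hkl => by
    have hind := (iIndepFun_pi (μ := fun _ : Fin K => M) (X := fun _ => g)
      fun _ => hg.aemeasurable).indepFun hkl
    have hmap : ∀ k, (Measure.pi fun _ : Fin K => M).map (fun z => g (z k)) = M.map g := fun k => by
      conv_rhs => rw [← (measurePreserving_eval (fun _ : Fin K => M) k).map_eq,
        Measure.map_map hg (measurable_pi_apply k)]
      rfl
    have hk : ∀ k, Measurable fun z : Fin K → E => g (z k) := fun k =>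
      hg.comp (measurable_pi_apply k)
    rw [indepFun_iff_map_prod_eq_prod_map_map (hk k).aemeasurable (hk l).aemeasurable, hmap,
      hmap] at hind
    have hD : MeasurableSet {x : Ω × Ω | x.1 = x.2} := measurableSet_eq_fun measurable_fst measurable_snd
    have h0 : ((M.map g).prod (M.map g)) {x : Ω × Ω | x.1 = x.2} = 0 := by
      rw [Measure.prod_apply hD]
      refine lintegral_eq_zero_of_ae_eq_zero (ae_of_all _ fun x => ?_)
      have : Prod.mk x ⁻¹' {x : Ω × Ω | x.1 = x.2} = {x} := by ext y; simp [eq_comm]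
      change (M.map g) (Prod.mk x ⁻¹' {x : Ω × Ω | x.1 = x.2}) = 0
      rw [this, measure_singleton]
    rw [← hind, Measure.map_apply ((hk k).prodMk (hk l)) hD] at h0
    rw [ae_iff]
    simpa using h0
  have hall : ∀ᵐ z ∂(Measure.pi fun _ : Fin K => M), ∀ k l, k ≠ l → g (z k) ≠ g (z l) := by
    simp only [ae_all_iff]
    exact hne
  filter_upwards [hall] with z hz k l hkl
  by_contra h
  exact hz k l h hkl

/-! ### Bernoulli processes with finitely many atoms -/

lemma lintegral_bern {r : ℝ} (h0 : 0 ≤ r) (h1 : r ≤ 1) (g : Bool → ℝ≥0∞) :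
    ∫⁻ b, g b ∂bern r = ENNReal.ofReal r * g true + ENNReal.ofReal (1 - r) * g false := by
  have hr : Set.projIcc (0 : ℝ) 1 zero_le_one r = ⟨r, h0, h1⟩ := Set.projIcc_of_mem _ ⟨h0, h1⟩
  rw [bern, hr, bernoulliMeasure_def, lintegral_add_measure, lintegral_smul_measure,
    lintegral_smul_measure, lintegral_dirac, lintegral_dirac, ENNReal.smul_def, ENNReal.smul_def,
    smul_eq_mul, smul_eq_mul]
  congr 2
  · rw [ENNReal.ofReal, Real.toNNReal_of_nonneg h0]; rfl
  · rw [ENNReal.ofReal, Real.toNNReal_of_nonneg (by linarith)]; rfl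

/-- The purely atomic measure with weights and positions `z_1, …, z_K`. -/
def atomicMeasure {Ω : Type*} [MeasurableSpace Ω] (K : ℕ) (z : Fin K → ℝ × Ω) : Measure Ω :=
  ∑ k, ENNReal.ofReal (z k).1 • Measure.dirac (z k).2

lemma weightedSum_sumDirac {Ω : Type*} [MeasurableSpace Ω] (K : ℕ) (z : Fin K → ℝ × Ω) :
    weightedSum (sumDirac K z) = atomicMeasure K z := by
  have hm : Measurable fun z : ℝ × Ω => ENNReal.ofReal z.1 := by fun_prop
  classical
  ext A hA
  rw [weightedSum, Measure.map_apply measurable_snd hA,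
    withDensity_apply _ (measurable_snd hA), ← lintegral_indicator (measurable_snd hA), sumDirac,
    lintegral_finsetSum_measure, atomicMeasure, Measure.coe_finsetSum, Finset.sum_apply]
  refine Finset.sum_congr rfl fun k _ => ?_
  rw [lintegral_dirac' _ (hm.indicator (measurable_snd hA)), Measure.smul_apply,
    Measure.dirac_apply' _ hA, smul_eq_mul, Set.indicator_apply, Set.indicator_apply]
  simp

lemma measurable_weightedSum {Ω : Type*} [MeasurableSpace Ω] :
    Measurable (weightedSum (Ω := Ω)) := by
  refine Measure.measurable_of_measurable_coe _ fun A hA => ?_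
  have hm : Measurable fun z : ℝ × Ω => ENNReal.ofReal z.1 := by fun_prop
  have : ∀ Φ : Measure (ℝ × Ω), weightedSum Φ A =
      ∫⁻ z, (Prod.snd ⁻¹' A).indicator (fun z => ENNReal.ofReal z.1) z ∂Φ := fun Φ => by
    rw [weightedSum, Measure.map_apply measurable_snd hA,
      withDensity_apply _ (measurable_snd hA), lintegral_indicator (measurable_snd hA)]
  simp_rw [this]
  exact Measure.measurable_lintegral (hm.indicator (measurable_snd hA))

section Atomic

variable {Ω : Type*} [MeasurableSpace Ω] [MeasurableSingletonClass Ω] {K : ℕ} {z : Fin K → ℝ × Ω}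

lemma atomicMeasure_singleton (hz : Function.Injective fun k => (z k).2) (k : Fin K) :
    atomicMeasure K z {(z k).2} = ENNReal.ofReal (z k).1 := by
  rw [atomicMeasure, Measure.coe_finsetSum, Finset.sum_apply, Finset.sum_eq_single k]
  · simp
  · intro l _ hl
    have : (z l).2 ≠ (z k).2 := fun h => hl (hz h)
    simp [this]
  · simp

/-- The atoms of `atomicMeasure` are labelled by `1, …, K`. -/
def atomEquiv (hz : Function.Injective fun k => (z k).2) (hpos : ∀ k, 0 < (z k).1) :
    Fin K ≃ {ω : Ω // atomicMeasure K z {ω} ≠ 0} :=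
  Equiv.ofBijective (fun k => ⟨(z k).2, by
      rw [atomicMeasure_singleton hz]; simpa using hpos k⟩) <| by
    refine ⟨fun k l h => hz (congrArg Subtype.val h), fun ω => ?_⟩
    by_contra h
    push Not at h
    refine ω.2 ?_
    change (∑ k, ENNReal.ofReal (z k).1 • Measure.dirac (z k).2 : Measure Ω) {ω.1} = 0
    rw [Measure.coe_finsetSum, Finset.sum_apply]
    refine Finset.sum_eq_zero fun k _ => ?_
    have : (z k).2 ≠ ω.1 := fun hk => h k (Subtype.ext hk)
    simp [this]

/-- With distinct positions and positive weights, the index set of the infinite product is in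
bijection with `Fin K`, so the product is a finite one. -/
lemma exists_bernoulliProcess_eq (hz : Function.Injective fun k => (z k).2)
    (hpos : ∀ k, 0 < (z k).1) :
    ∃ _ : Fintype {ω : Ω // atomicMeasure K z {ω} ≠ 0},
      bernoulliProcess (atomicMeasure K z) =
        (Measure.pi fun ω : {ω : Ω // atomicMeasure K z {ω} ≠ 0} =>
          bern (atomicMeasure K z {ω.1}).toReal).map
          fun b => ∑ ω, if b ω = true then Measure.dirac ω.1 else 0 := by
  have hF := Fintype.ofEquiv _ (atomEquiv hz hpos)
  refine ⟨hF, ?_⟩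
  rw [bernoulliProcess, Measure.infinitePi_eq_pi]
  simp_rw [Measure.sum_fintype]

end Atomic

lemma measurable_sum_ite_dirac {Ω S : Type*} [MeasurableSpace Ω] [Fintype S] (ω : S → Ω) :
    Measurable fun b : S → Bool => ∑ s, if b s = true then Measure.dirac (ω s) else 0 :=
  measurable_finset_sum_measure _ fun s _ =>
    (measurable_of_countable fun b : Bool => if b = true then Measure.dirac (ω s) else 0).comp
      (measurable_pi_apply s)

section Atomic

variable {Ω : Type*} [MeasurableSpace Ω] [MeasurableSingletonClass Ω] {K : ℕ} {z : Fin K → ℝ × Ω}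

lemma isProbabilityMeasure_bernoulliProcess (hz : Function.Injective fun k => (z k).2)
    (hpos : ∀ k, 0 < (z k).1) : IsProbabilityMeasure (bernoulliProcess (atomicMeasure K z)) := by
  obtain ⟨_, h⟩ := exists_bernoulliProcess_eq hz hpos
  rw [h]
  exact Measure.isProbabilityMeasure_map (measurable_sum_ite_dirac _).aemeasurable

/-- The Laplace functional of a Bernoulli process. -/
lemma lintegral_bernoulliProcess (hz : Function.Injective fun k => (z k).2)
    (hpos : ∀ k, 0 < (z k).1) (hle : ∀ k, (z k).1 ≤ 1) {f : Ω → ℝ≥0∞} (hf : Measurable f) :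
    ∫⁻ x, expNeg (∫⁻ ω, f ω ∂x) ∂(bernoulliProcess (atomicMeasure K z)) =
      ∏ k, (ENNReal.ofReal (z k).1 * expNeg (f (z k).2) + ENNReal.ofReal (1 - (z k).1)) := by
  obtain ⟨_, h⟩ := exists_bernoulliProcess_eq hz hpos
  have hm : Measurable fun x : Measure Ω => expNeg (∫⁻ ω, f ω ∂x) :=
    measurable_expNeg.comp (Measure.measurable_lintegral hf)
  rw [h, lintegral_map hm (measurable_sum_ite_dirac _)]
  have hexp : ∀ b : {ω : Ω // atomicMeasure K z {ω} ≠ 0} → Bool,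
      expNeg (∫⁻ ω, f ω ∂(∑ ω, if b ω = true then Measure.dirac ω.1 else 0)) =
        ∏ ω, (if b ω = true then expNeg (f ω.1) else 1) := fun b => by
    rw [lintegral_finsetSum_measure, expNeg_sum]
    refine Finset.prod_congr rfl fun ω _ => ?_
    split_ifs
    · rw [lintegral_dirac]
    · simp
  simp_rw [hexp]
  rw [lintegral_pi_prod _ (f := fun (ω : {ω : Ω // atomicMeasure K z {ω} ≠ 0}) (b : Bool) =>
      if b = true then expNeg (f ω.1) else 1)
    fun _ => measurable_of_countable _, ← (atomEquiv hz hpos).prod_comp]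
  refine Finset.prod_congr rfl fun k _ => ?_
  have hv : (atomicMeasure K z {((atomEquiv hz hpos) k).1}).toReal = (z k).1 := by
    change (atomicMeasure K z {(z k).2}).toReal = _
    rw [atomicMeasure_singleton hz, ENNReal.toReal_ofReal (hpos k).le]
  rw [hv, lintegral_bern (hpos k).le (hle k)]
  rw [if_pos rfl, if_neg Bool.false_ne_true, mul_one]
  rfl

end Atomic

/-! ### Laplace functionals of the rows -/

/-- Finite laws of finitely many random measures are determined by their joint Laplace
functionals. -/
theorem ext_of_laplace_rows {Ω : Type*} [MeasurableSpace Ω] {p : ℕ}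
    {Q₁ Q₂ : Measure (Fin p → Measure Ω)} [IsFiniteMeasure Q₁] [IsFiniteMeasure Q₂]
    (h : ∀ f : Fin p → Ω → ℝ≥0∞, (∀ j, Measurable (f j)) →
      ∫⁻ x, ∏ j, expNeg (∫⁻ ω, f j ω ∂x j) ∂Q₁ = ∫⁻ x, ∏ j, expNeg (∫⁻ ω, f j ω ∂x j) ∂Q₂) :
    Q₁ = Q₂ := by
  classical
  refine ext_of_laplace (T := Fin p × {A : Set Ω // MeasurableSet A}) (fun t x => x t.1 t.2.1) ?_
    fun I k => ?_
  · simp only [MeasurableSpace.pi, MeasurableSpace.comap_iSup, MeasurableSpace.comap_comp,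
      Measure.instMeasurableSpace, iSup_subtype, iSup_prod]
    rfl
  · let f : Fin p → Ω → ℝ≥0∞ := fun j ω =>
      ∑ t ∈ I, t.2.1.indicator (fun _ => if t.1 = j then (k t : ℝ≥0∞) else 0) ω
    have hf : ∀ x : Fin p → Measure Ω,
        ∏ j, expNeg (∫⁻ ω, f j ω ∂x j) = expNeg (∑ t ∈ I, k t * x t.1 t.2.1) := fun x => by
      rw [← expNeg_sum]
      congr 1
      simp only [f]
      simp_rw [lintegral_finsetSum _ fun (t : Fin p × {A : Set Ω // MeasurableSet A}) (_ : t ∈ I) =>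
        measurable_const.indicator t.2.2]
      rw [Finset.sum_comm]
      refine Finset.sum_congr rfl fun t _ => ?_
      simp_rw [lintegral_indicator_const t.2.2]
      rw [Finset.sum_eq_single t.1 (fun j _ hj => by simp [hj.symm]) (by simp)]
      simp
    simpa only [hf] using h f fun j => Finset.measurable_sum _ fun t _ =>
      measurable_const.indicator t.2.2

lemma measurable_rows_laplace {Ω : Type*} [MeasurableSpace Ω] {p : ℕ} {f : Fin p → Ω → ℝ≥0∞}
    (hf : ∀ j, Measurable (f j)) :
    Measurable fun x : Fin p → Measure Ω => ∏ j, expNeg (∫⁻ ω, f j ω ∂x j) :=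
  Finset.measurable_prod _ fun j _ =>
    (measurable_expNeg.comp (Measure.measurable_lintegral (hf j))).comp (measurable_pi_apply j)

/-- The expected contribution `∫ e^{-∑_j u_j f_j} dΛ₀` of an atom with column `u`. -/
def colLaplace {Ω : Type*} [MeasurableSpace Ω] {p : ℕ} (Λ₀ : Measure Ω) (f : Fin p → Ω → ℝ≥0∞)
    (u : Fin p → Bool) : ℝ≥0∞ :=
  ∫⁻ ω, ∏ j, (if u j = true then expNeg (f j ω) else 1) ∂Λ₀

section

variable {Ω : Type*} [MeasurableSpace Ω] {p : ℕ} {Λ₀ : Measure Ω} [IsProbabilityMeasure Λ₀]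
  {f : Fin p → Ω → ℝ≥0∞}

lemma colLaplace_le_one (u : Fin p → Bool) : colLaplace Λ₀ f u ≤ 1 := by
  refine (lintegral_mono fun ω => Finset.prod_le_one' fun j _ => ?_).trans_eq (b := ∫⁻ _, 1 ∂Λ₀)
    (by simp)
  split_ifs
  · exact expNeg_le_one _
  · exact le_rfl

lemma colLaplace_ne_top (u : Fin p → Bool) : colLaplace Λ₀ f u ≠ ∞ :=
  ((colLaplace_le_one u).trans_lt ENNReal.one_lt_top).ne

lemma colLaplace_false : colLaplace Λ₀ f (fun _ => false) = 1 := by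
  simp [colLaplace]

/-- Expanding the product chooses for each row whether it carries the atom, that is, a column $u$.
In each term weight and position separate, leaving a beta moment times an integral over $\Lambda_0$.
-/
lemma lintegral_prod_bernoulli {α κ : ℝ} (hα : 0 < α) (hκ : 0 ≤ κ) (hf : ∀ j, Measurable (f j)) :
    ∫⁻ z, ∏ j, (ENNReal.ofReal z.1 * expNeg (f j z.2) + ENNReal.ofReal (1 - z.1))
      ∂(betaMeasure α (κ + 1)).prod Λ₀ =
      ∑ u : Fin p → Bool, ENNReal.ofReal (colWeight α κ u) * colLaplace Λ₀ f u := by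
  have := isProbabilityMeasureBeta hα (show 0 < κ + 1 by linarith)
  have h : ∀ z : ℝ × Ω,
      ∏ j, (ENNReal.ofReal z.1 * expNeg (f j z.2) + ENNReal.ofReal (1 - z.1)) =
      ∑ u : Fin p → Bool,
        (∏ j, if u j = true then ENNReal.ofReal z.1 else ENNReal.ofReal (1 - z.1)) *
          ∏ j, (if u j = true then expNeg (f j z.2) else 1) := fun z => by
    have := Finset.prod_univ_sum (fun _ : Fin p => (Finset.univ : Finset Bool))
      fun j b => if b = true then ENNReal.ofReal z.1 * expNeg (f j z.2) else ENNReal.ofReal (1 - z.1)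
    simp only [Fintype.sum_bool, if_true, Bool.false_eq_true, if_false, Fintype.piFinset_univ] at this
    rw [this]
    refine Finset.sum_congr rfl fun u _ => ?_
    rw [← Finset.prod_mul_distrib]
    refine Finset.prod_congr rfl fun j _ => ?_
    split_ifs <;> simp
  have hm1 : ∀ u : Fin p → Bool, Measurable fun q : ℝ =>
      ∏ j, (if u j = true then ENNReal.ofReal q else ENNReal.ofReal (1 - q)) := fun u =>
    Finset.measurable_prod _ fun j _ => by split_ifs <;> fun_prop
  have hm2 : ∀ u : Fin p → Bool, Measurable fun ω : Ω =>
      ∏ j, (if u j = true then expNeg (f j ω) else 1) := fun u =>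
    Finset.measurable_prod _ fun j _ => by
      split_ifs
      · exact measurable_expNeg.comp (hf j)
      · exact measurable_const
  simp_rw [h]
  have hm : ∀ u : Fin p → Bool, Measurable fun z : ℝ × Ω =>
      (∏ j, if u j = true then ENNReal.ofReal z.1 else ENNReal.ofReal (1 - z.1)) *
        ∏ j, (if u j = true then expNeg (f j z.2) else 1) := fun u =>
    ((hm1 u).comp measurable_fst).mul ((hm2 u).comp measurable_snd)
  rw [lintegral_finsetSum _ fun u _ => hm u]
  refine Finset.sum_congr rfl fun u _ => ?_
  rw [lintegral_prod_mul (hm1 u).aemeasurable (hm2 u).aemeasurable, lintegral_colWeight hα hκ]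
  rfl

end

/-- The real exponent shared by the two Laplace functionals. -/
lemma sum_colWeight_mul_colLaplace {Ω : Type*} [MeasurableSpace Ω] {p : ℕ} {Λ₀ : Measure Ω}
    [IsProbabilityMeasure Λ₀] {f : Fin p → Ω → ℝ≥0∞} {α κ : ℝ} (hα : 0 < α) (hκ : 0 ≤ κ) :
    (∑ u : Fin p → Bool, ENNReal.ofReal (colWeight α κ u) * colLaplace Λ₀ f u).toReal =
      1 - tastedMass p α κ + ∑ u : NonzeroCol p, colWeight α κ u.1 * (colLaplace Λ₀ f u.1).toReal := by
  rw [ENNReal.toReal_sum fun u _ => ENNReal.mul_ne_top ENNReal.ofReal_ne_top (colLaplace_ne_top u)]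
  simp_rw [ENNReal.toReal_mul, ENNReal.toReal_ofReal (colWeight_pos hα hκ _).le]
  rw [sum_nonzeroCol, colLaplace_false, ENNReal.toReal_one, mul_one]
  linarith [colWeight_false_add hα hκ p]

/-- The joint Laplace functional of conditionally iid Bernoulli processes with a beta-type
completely random mean measure. -/
theorem lintegral_map_rows {Ω S : Type*} [MeasurableSpace Ω] [MeasurableSingletonClass Ω]
    [MeasurableEq Ω] [MeasurableSpace S] {P : Measure S} [IsProbabilityMeasure P]
    {γ α κ : ℝ} (hγ : 0 < γ) (hα : 0 < α) (hκ : 0 ≤ κ)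
    {Λ₀ : Measure Ω} [IsProbabilityMeasure Λ₀] [NullSingletonClass Λ₀]
    {p : ℕ} {μ : S → Measure Ω} {ξ : Fin p → S → Measure Ω}
    (hμ : IsCRM P μ (levyIntensity γ α κ Λ₀)) (hξ : IsCondIIDBernoulli P ξ μ)
    {f : Fin p → Ω → ℝ≥0∞} (hf : ∀ j, Measurable (f j)) :
    ∫⁻ x, ∏ j, expNeg (∫⁻ ω, f j ω ∂x j) ∂P.map (fun s j => ξ j s) =
      ENNReal.ofReal (Real.exp (γ * (∑ u : NonzeroCol p,
        colWeight α κ u.1 * (colLaplace Λ₀ f u.1).toReal - tastedMass p α κ))) := by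
  have := isProbabilityMeasureBeta hα (show 0 < κ + 1 by linarith)
  obtain ⟨hμm, Q, hQ, hPQ⟩ := hμ
  obtain ⟨hξm, hlaw⟩ := hξ
  set F : (Fin p → Measure Ω) → ℝ≥0∞ := fun x => ∏ j, expNeg (∫⁻ ω, f j ω ∂x j) with hFdef
  have hF : Measurable F := measurable_rows_laplace hf
  have hξ' : Measurable fun s j => ξ j s := measurable_pi_lambda _ hξm
  have hpair : Measurable fun s => (μ s, fun j => ξ j s) := hμm.prodMk hξ'
  set κ' : Measure Ω → Measure (Measure Ω × (Fin p → Measure Ω)) := fun m =>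
    (Measure.pi fun _ : Fin p => bernoulliProcess m).map (Prod.mk m) with hκ'
  -- The mixture of the conditional laws is a probability measure, so its kernel is measurable.
  have hae : AEMeasurable κ' (P.map μ) := by
    by_contra hnot
    have h0 : P.map (fun s => (μ s, fun j => ξ j s)) = 0 := by
      rw [hlaw, Measure.bind, Measure.map_of_not_aemeasurable hnot]
      simp
    have := Measure.isProbabilityMeasure_map (μ := P) hpair.aemeasurable
    exact IsProbabilityMeasure.ne_zero _ h0
  set G : Measure Ω → ℝ≥0∞ := fun m => ∫⁻ y, F y.2 ∂κ' m with hG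
  have hGae : AEMeasurable G (P.map μ) :=
    (Measure.measurable_lintegral (hF.comp measurable_snd)).comp_aemeasurable hae
  have h1 : ∫⁻ x, F x ∂P.map (fun s j => ξ j s) = ∫⁻ m, G m ∂P.map μ := by
    have hsnd : P.map (fun s j => ξ j s) = (P.map fun s => (μ s, fun j => ξ j s)).map Prod.snd := by
      rw [Measure.map_map measurable_snd hpair]; rfl
    have hb := Measure.lintegral_bind hae
      (hF.comp measurable_snd).aemeasurable
    rw [hsnd, lintegral_map hF measurable_snd, hlaw]
    exact hb
  have hr : γ.toNNReal ≠ 0 := by simpa using hγ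
  have hψ : ∀ K, Measurable (atomicMeasure (Ω := Ω) K) := fun K => by
    have : atomicMeasure (Ω := Ω) K = weightedSum ∘ sumDirac K := by
      funext z; exact (weightedSum_sumDirac K z).symm
    rw [this]
    exact measurable_weightedSum.comp (measurable_sumDirac K)
  -- Finite activity makes $\mu$ a Poisson number of independent weighted atoms, so its generating
  -- functional is explicit.
  have hPμ : P.map μ = poissonized γ.toNNReal ((betaMeasure α (κ + 1)).prod Λ₀) atomicMeasure := by
    rw [levyIntensity_eq hγ] at hQ
    rw [hPQ, hQ.eq_poissonized hr, poissonized_map measurable_sumDirac measurable_weightedSum]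
    simp_rw [weightedSum_sumDirac]
  rw [h1, hPμ]
  rw [hPμ] at hGae
  have hh : Measurable fun z : ℝ × Ω =>
      ∏ j, (ENNReal.ofReal z.1 * expNeg (f j z.2) + ENNReal.ofReal (1 - z.1)) :=
    Finset.measurable_prod _ fun j _ =>
      ((measurable_fst.ennreal_ofReal).mul (measurable_expNeg.comp ((hf j).comp measurable_snd))).add
        (by fun_prop)
  have hval := lintegral_prod_bernoulli (Λ₀ := Λ₀) hα hκ hf
  have hsnd : ((betaMeasure α (κ + 1)).prod Λ₀).map Prod.snd = Λ₀ := by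
    rw [← Measure.snd, Measure.snd_prod]
  have hna : NullSingletonClass (((betaMeasure α (κ + 1)).prod Λ₀).map Prod.snd) := by
    rw [hsnd]; infer_instance
  rw [lintegral_poissonized hr hψ hGae hh]
  · rw [hval, sum_colWeight_mul_colLaplace hα hκ, Real.coe_toNNReal _ hγ.le]
    congr 2; ring
  · rw [hval]
    exact ENNReal.sum_ne_top.mpr fun u _ =>
      ENNReal.mul_ne_top ENNReal.ofReal_ne_top (colLaplace_ne_top u)
  · intro K
    have hq : ∀ᵐ z ∂(Measure.pi fun _ : Fin K => (betaMeasure α (κ + 1)).prod Λ₀),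
        ∀ k, 0 < (z k).1 ∧ (z k).1 < 1 := by
      rw [ae_all_iff]
      intro k
      have h2 : ∀ᵐ z ∂(betaMeasure α (κ + 1)).prod Λ₀, 0 < z.1 ∧ z.1 < 1 :=
        Measure.quasiMeasurePreserving_fst.ae (ae_betaMeasure α (κ + 1))
      exact (measurePreserving_eval (fun _ : Fin K => (betaMeasure α (κ + 1)).prod Λ₀)
        k).quasiMeasurePreserving.ae h2
    filter_upwards [hq, ae_pi_injective ((betaMeasure α (κ + 1)).prod Λ₀) measurable_snd K]
      with z hz hinj
    have := isProbabilityMeasure_bernoulliProcess hinj fun k => (hz k).1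
    rw [hG]
    simp only [hκ']
    have hFs : Measurable fun y : Measure Ω × (Fin p → Measure Ω) => F y.2 := hF.comp measurable_snd
    rw [lintegral_map hFs measurable_prodMk_left, hFdef]
    have hj : ∀ j, Measurable fun x : Measure Ω => expNeg (∫⁻ ω, f j ω ∂x) := fun j =>
      measurable_expNeg.comp (Measure.measurable_lintegral (hf j))
    -- Conditional independence gives a product over rows. Exchanging it with the product over atoms
    -- shows that each atom contributes one factor, as `lintegral_poissonized` requires.
    rw [lintegral_pi_prod (fun _ : Fin p => bernoulliProcess (atomicMeasure K z)) hj,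
      Finset.prod_comm]
    refine Finset.prod_congr rfl fun j _ => ?_
    exact lintegral_bernoulliProcess hinj (fun k => (hz k).1) (fun k => (hz k).2.le) (hf j)

/-! ### The joint law of the rows -/

/-- Tonelli, one coordinate at a time. The reference measure $\nu$ is only $\sigma$-finite, so the
independence argument for probability measures does not apply. -/
lemma lintegral_pi_fin_prod {X : Type*} [MeasurableSpace X] {n : ℕ} (ρ : Fin n → Measure X)
    [∀ i, SigmaFinite (ρ i)] {f : Fin n → X → ℝ≥0∞} (hf : ∀ i, Measurable (f i)) :
    ∫⁻ x, ∏ i, f i (x i) ∂Measure.pi ρ = ∏ i, ∫⁻ x, f i x ∂ρ i := by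
  induction n with
  | zero => simp
  | succ n ih =>
    have hm : Measurable fun x : Fin n → X => ∏ i, f i.succ (x i) :=
      Finset.measurable_prod _ fun i _ => (hf _).comp (measurable_pi_apply i)
    have hg : Measurable fun y : X × (Fin n → X) => f 0 y.1 * ∏ i : Fin n, f i.succ (y.2 i) :=
      ((hf 0).comp measurable_fst).mul (hm.comp measurable_snd)
    have hmp := measurePreserving_piFinSuccAbove (fun i => ρ i) 0
    have h := hmp.lintegral_comp hg
    rw [Fin.prod_univ_succ, ← ih (fun i => ρ i.succ) fun i => hf i.succ,
      ← lintegral_prod_mul (hf 0).aemeasurable hm.aemeasurable]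
    refine Eq.trans ?_ h
    refine lintegral_congr fun x => ?_
    rw [Fin.prod_univ_succ]
    rfl

/-- Both sides agree on boxes. This absorbs the factors $\lambda_0(\omega_k)$ of the density into
independent positions with law $\Lambda_0$. -/
lemma pi_withDensity {X : Type*} [MeasurableSpace X] (n : ℕ) (ν : Measure X) [SigmaFinite ν]
    {g : X → ℝ≥0∞} (hg : Measurable g) [SigmaFinite (ν.withDensity g)] :
    (Measure.pi fun _ : Fin n => ν).withDensity (fun x => ∏ k, g (x k)) =
      Measure.pi fun _ : Fin n => ν.withDensity g := by
  refine (Measure.pi_eq fun s hs => ?_).symm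
  rw [withDensity_apply _ (.univ_pi hs), Measure.restrict_pi_pi,
    lintegral_pi_fin_prod _ fun _ => hg]
  exact Finset.prod_congr rfl fun k _ => (withDensity_apply _ (hs k)).symm

lemma measurable_rowsOf {Ω : Type*} [MeasurableSpace Ω] {p K : ℕ} (u : Fin K → NonzeroCol p) :
    Measurable (rowsOf (Ω := Ω) u) :=
  measurable_pi_lambda _ fun j => measurable_finset_sum_measure _ fun k _ => by
    split_ifs
    · exact Measure.measurable_dirac.comp (measurable_pi_apply k)
    · exact measurable_const

/-- The law of the rows, as a mixture over the columns. -/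
lemma cibpLaw_eq {Ω : Type*} [MeasurableSpace Ω] {p : ℕ} {γ α κ : ℝ} {ν : Measure Ω}
    [SigmaFinite ν] {lam0 : Ω → ℝ≥0∞} (hlam0 : Measurable lam0) {Λ₀ : Measure Ω}
    [IsProbabilityMeasure Λ₀] (hΛ₀ : Λ₀ = ν.withDensity lam0) :
    cibpLaw p γ α κ ν lam0 = Measure.sum fun K : ℕ => (K.factorial : ℝ≥0∞)⁻¹ •
      ∑ u : Fin K → NonzeroCol p,
        (ENNReal.ofReal (Real.exp (-γ * tastedMass p α κ)) *
          ∏ k, ENNReal.ofReal (γ * colWeight α κ (u k).1)) •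
          (Measure.pi fun _ : Fin K => Λ₀).map (rowsOf u) := by
  rw [cibpLaw]
  congr 1
  funext K
  congr 1
  refine Finset.sum_congr rfl fun u _ => ?_
  have hdens : cibpDensity γ α κ lam0 u =
      (ENNReal.ofReal (Real.exp (-γ * tastedMass p α κ)) *
        ∏ k, ENNReal.ofReal (γ * colWeight α κ (u k).1)) • fun ω : Fin K → Ω => ∏ k, lam0 (ω k) := by
    funext ω
    rw [cibpDensity, Finset.prod_mul_distrib, ← mul_assoc]
    rfl
  have : SigmaFinite (ν.withDensity lam0) := by rw [← hΛ₀]; infer_instance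
  have hm : Measurable fun ω : Fin K → Ω => ∏ k, lam0 (ω k) :=
    Finset.measurable_prod _ fun k _ => hlam0.comp (measurable_pi_apply k)
  rw [hdens, withDensity_smul _ hm, pi_withDensity K ν hlam0, ← hΛ₀, Measure.map_smul]

/-- The joint Laplace functional of `cibpLaw`. -/
lemma lintegral_cibpLaw {Ω : Type*} [MeasurableSpace Ω] {p : ℕ} {γ α κ : ℝ} (hγ : 0 < γ)
    (hα : 0 < α) (hκ : 0 ≤ κ) {ν : Measure Ω}
    [SigmaFinite ν] {lam0 : Ω → ℝ≥0∞} (hlam0 : Measurable lam0) {Λ₀ : Measure Ω}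
    [IsProbabilityMeasure Λ₀] (hΛ₀ : Λ₀ = ν.withDensity lam0)
    {f : Fin p → Ω → ℝ≥0∞} (hf : ∀ j, Measurable (f j)) :
    ∫⁻ x, ∏ j, expNeg (∫⁻ ω, f j ω ∂x j) ∂cibpLaw p γ α κ ν lam0 =
      ENNReal.ofReal (Real.exp (γ * (∑ u : NonzeroCol p,
        colWeight α κ u.1 * (colLaplace Λ₀ f u.1).toReal - tastedMass p α κ))) := by
  have hF : Measurable fun x : Fin p → Measure Ω => ∏ j, expNeg (∫⁻ ω, f j ω ∂x j) :=
    measurable_rows_laplace hf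
  have hcol : ∀ u : Fin p → Bool, Measurable fun ω : Ω =>
      ∏ j, (if u j = true then expNeg (f j ω) else 1) := fun u =>
    Finset.measurable_prod _ fun j _ => by
      split_ifs
      · exact measurable_expNeg.comp (hf j)
      · exact measurable_const
  have hrow : ∀ (K : ℕ) (u : Fin K → NonzeroCol p),
      ∫⁻ x, ∏ j, expNeg (∫⁻ ω, f j ω ∂x j) ∂(Measure.pi fun _ : Fin K => Λ₀).map (rowsOf u) =
        ∏ k, colLaplace Λ₀ f (u k).1 := fun K u => by
    rw [lintegral_map hF (measurable_rowsOf u)]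
    have hv : ∀ ω : Fin K → Ω, ∏ j, expNeg (∫⁻ ω', f j ω' ∂rowsOf u ω j) =
        ∏ k, ∏ j, (if (u k).1 j = true then expNeg (f j (ω k)) else 1) := fun ω => by
      rw [Finset.prod_comm]
      refine Finset.prod_congr rfl fun j _ => ?_
      rw [rowsOf, lintegral_finsetSum_measure, expNeg_sum]
      refine Finset.prod_congr rfl fun k _ => ?_
      split_ifs
      · rw [lintegral_dirac' _ (hf j)]
      · simp
    simp_rw [hv]
    rw [lintegral_pi_fin_prod _ fun k => hcol (u k).1]
    rfl
  set w : NonzeroCol p → ℝ := fun u => γ * colWeight α κ u.1 * (colLaplace Λ₀ f u.1).toReal with hw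
  have hw0 : ∀ u, 0 ≤ w u := fun u =>
    mul_nonneg (mul_nonneg hγ.le (colWeight_pos hα hκ _).le) ENNReal.toReal_nonneg
  rw [cibpLaw_eq hlam0 hΛ₀, lintegral_sum_measure]
  have hterm : ∀ K : ℕ, ∫⁻ x, ∏ j, expNeg (∫⁻ ω, f j ω ∂x j) ∂((K.factorial : ℝ≥0∞)⁻¹ •
      ∑ u : Fin K → NonzeroCol p,
        (ENNReal.ofReal (Real.exp (-γ * tastedMass p α κ)) *
          ∏ k, ENNReal.ofReal (γ * colWeight α κ (u k).1)) •
          (Measure.pi fun _ : Fin K => Λ₀).map (rowsOf u)) =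
      ENNReal.ofReal (Real.exp (-γ * tastedMass p α κ)) *
        ((K.factorial : ℝ≥0∞)⁻¹ * ENNReal.ofReal (∑ u, w u) ^ K) := fun K => by
    -- The sum over all labellings of $\prod_k w(u_k)$ is $(\sum_u w_u)^K$; with $1/K!$ it becomes a
    -- term of the exponential series.
    rw [lintegral_smul_measure, lintegral_finsetSum_measure, smul_eq_mul,
      ENNReal.ofReal_sum_of_nonneg fun u _ => hw0 u, Fintype.sum_pow, mul_left_comm]
    congr 1
    rw [Finset.mul_sum]
    refine Finset.sum_congr rfl fun u _ => ?_
    rw [lintegral_smul_measure, hrow, smul_eq_mul, mul_assoc, ← Finset.prod_mul_distrib]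
    congr 1
    refine Finset.prod_congr rfl fun k _ => ?_
    rw [hw, ENNReal.ofReal_mul (mul_nonneg hγ.le (colWeight_pos hα hκ _).le),
      ENNReal.ofReal_toReal (colLaplace_ne_top _)]
  simp_rw [hterm]
  rw [ENNReal.tsum_mul_left, tsum_inv_factorial_mul_pow (Finset.sum_nonneg fun u _ => hw0 u),
    ← ENNReal.ofReal_mul (Real.exp_pos _).le, ← Real.exp_add]
  congr 2
  simp only [hw, mul_assoc]
  rw [← Finset.mul_sum]
  ring

theorem map_rows_eq_cibpLaw {Ω S : Type*} [MeasurableSpace Ω] [MeasurableSingletonClass Ω]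
    [MeasurableEq Ω] [MeasurableSpace S] {P : Measure S} [IsProbabilityMeasure P]
    {γ α κ : ℝ} (hγ : 0 < γ) (hα : 0 < α) (hκ : 0 ≤ κ) {ν : Measure Ω}
    [SigmaFinite ν] {lam0 : Ω → ℝ≥0∞} (hlam0 : Measurable lam0)
    {Λ₀ : Measure Ω} [IsProbabilityMeasure Λ₀] [NullSingletonClass Λ₀]
    (hΛ₀ : Λ₀ = ν.withDensity lam0)
    {p : ℕ} {μ : S → Measure Ω} {ξ : Fin p → S → Measure Ω}
    (hμ : IsCRM P μ (levyIntensity γ α κ Λ₀)) (hξ : IsCondIIDBernoulli P ξ μ) :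
    P.map (fun s j => ξ j s) = cibpLaw p γ α κ ν lam0 := by
  have hmeas : Measurable fun s j => ξ j s := measurable_pi_lambda _ hξ.1
  have := Measure.isProbabilityMeasure_map (μ := P) hmeas.aemeasurable
  have hfin : IsFiniteMeasure (cibpLaw p γ α κ ν lam0) := by
    refine ⟨?_⟩
    -- The total mass is the Laplace functional at $f=0$, hence finite.
    have h := lintegral_cibpLaw (f := fun (_ : Fin p) (_ : Ω) => 0) hγ hα hκ hlam0 hΛ₀
      fun _ => measurable_const
    simp only [lintegral_zero, expNeg_zero, Finset.prod_const_one, lintegral_one] at h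
    rw [h]
    exact ENNReal.ofReal_lt_top
  refine ext_of_laplace_rows fun f hf => ?_
  rw [lintegral_map_rows hγ hα hκ hμ hξ hf, lintegral_cibpLaw hγ hα hκ hlam0 hΛ₀ hf]

/-! ### Finite configurations and their atom counts -/

/-- The measure `x` is the counting measure of a finite set. -/
def IsFiniteConfig {Ω : Type*} [MeasurableSpace Ω] (x : Measure Ω) : Prop :=
  ∃ S : Finset Ω, x = ∑ ω ∈ S, Measure.dirac ω

lemma sum_dirac_singleton {Ω : Type*} [MeasurableSpace Ω] [MeasurableSingletonClass Ω] (S : Finset Ω) (ω : Ω) [Decidable (ω ∈ S)] :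
    (∑ ω' ∈ S, Measure.dirac ω' : Measure Ω) {ω} = if ω ∈ S then 1 else 0 := by
  classical
  rw [Measure.coe_finsetSum, Finset.sum_apply]
  simp [Set.indicator_apply, Finset.sum_ite_eq']

/-- The first `m` binary digits of a point. -/
def code {Ω : Type*} [MeasurableSpace Ω] [MeasurableSpace.CountablyGenerated Ω] (m : ℕ) (ω : Ω) :
    Fin m → Bool :=
  fun i => MeasurableSpace.mapNatBool Ω ω i

section

variable {Ω : Type*} [MeasurableSpace Ω] [MeasurableSpace.CountablyGenerated Ω]

lemma measurable_code (m : ℕ) : Measurable (code (Ω := Ω) m) :=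
  measurable_pi_lambda _ fun i =>
    (measurable_pi_apply (i : ℕ)).comp (MeasurableSpace.measurable_mapNatBool Ω)

lemma measurableSet_cell (m : ℕ) (σ : Fin m → Bool) : MeasurableSet (code (Ω := Ω) m ⁻¹' {σ}) :=
  measurable_code m (measurableSet_singleton σ)

lemma code_eq_of_le {m n : ℕ} (h : m ≤ n) {ω ω' : Ω} (he : code n ω = code n ω') :
    code m ω = code m ω' := by
  funext i
  exact congrFun he (Fin.castLE h i)

open Classical in
/-- The number of cells of level `m` in which the rows have the masses given by the column `u`. -/
def cellCount {p : ℕ} (m : ℕ) (x : Fin p → Measure Ω) (u : NonzeroCol p) : ℕ :=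
  (Finset.univ.filter fun σ : Fin m → Bool =>
    ∀ j, x j (code m ⁻¹' {σ}) = if u.1 j = true then 1 else 0).card

lemma measurable_cellCount {p : ℕ} (m : ℕ) (u : NonzeroCol p) :
    Measurable fun x : Fin p → Measure Ω => cellCount m x u := by
  classical
  simp only [cellCount, Finset.card_filter]
  refine Finset.measurable_sum _ fun σ _ => Measurable.ite ?_ measurable_const measurable_const
  rw [Set.ofPred_forall]
  refine .iInter fun j => ?_
  exact ((Measure.measurable_coe (measurableSet_cell m σ)).comp (measurable_pi_apply j))
    (measurableSet_singleton _)

lemma sum_dirac_cell {m : ℕ} {S R : Finset Ω} (hS : Set.InjOn (code (Ω := Ω) m) R) (hSR : S ⊆ R)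
    {ω : Ω} (hω : ω ∈ R) [Decidable (ω ∈ S)] :
    (∑ ω' ∈ S, Measure.dirac ω' : Measure Ω) (code m ⁻¹' {code m ω}) = if ω ∈ S then 1 else 0 := by
  classical
  rw [Measure.coe_finsetSum, Finset.sum_apply]
  have : ∀ ω' ∈ S, Measure.dirac ω' (code m ⁻¹' {code m ω}) =
      if ω' = ω then (1 : ℝ≥0∞) else 0 := fun ω' hω' => by
    rw [Measure.dirac_apply' _ (measurableSet_cell _ _), Set.indicator_apply]
    refine if_congr ?_ rfl rfl
    exact ⟨fun h => hS (hSR hω') hω h, fun h => by rw [h]; rfl⟩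
  rw [Finset.sum_congr rfl this]
  by_cases h : ω ∈ S
  · rw [if_pos h, Finset.sum_eq_single_of_mem ω h fun _ _ hne => if_neg hne, if_pos rfl]
  · rw [if_neg h]
    exact Finset.sum_eq_zero fun ω' h' => if_neg (ne_of_mem_of_not_mem h' h)

lemma sum_dirac_cell_eq_zero {m : ℕ} {S : Finset Ω} {σ : Fin m → Bool}
    (hσ : ∀ ω ∈ S, code m ω ≠ σ) :
    (∑ ω' ∈ S, Measure.dirac ω' : Measure Ω) (code m ⁻¹' {σ}) = 0 := by
  rw [Measure.coe_finsetSum, Finset.sum_apply]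
  refine Finset.sum_eq_zero fun ω hω => ?_
  rw [Measure.dirac_apply' _ (measurableSet_cell _ _),
    Set.indicator_of_notMem (s := code m ⁻¹' {σ}) fun h => hσ ω hω h]

variable [MeasurableSpace.SeparatesPoints Ω]

lemma eq_of_code_eq {ω ω' : Ω} (h : ∀ m, code m ω = code m ω') : ω = ω' := by
  refine MeasurableSpace.injective_mapNatBool Ω (funext fun n => ?_)
  exact congrFun (h (n + 1)) (Fin.last n)

lemma eventually_injOn_code (S : Finset Ω) :
    ∀ᶠ m in Filter.atTop, Set.InjOn (code (Ω := Ω) m) S := by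
  have h : ∀ ω ω' : Ω, ∀ᶠ m in Filter.atTop, code m ω = code m ω' → ω = ω' := fun ω ω' => by
    by_cases hne : ω = ω'
    · exact Filter.Eventually.of_forall fun _ _ => hne
    · have : ∃ m, code m ω ≠ code m ω' := by
        by_contra! hc
        exact hne (eq_of_code_eq hc)
      obtain ⟨m₀, hm₀⟩ := this
      filter_upwards [Filter.eventually_ge_atTop m₀] with m hm he
      exact absurd (code_eq_of_le hm he) hm₀
  have h2 : ∀ᶠ m in Filter.atTop, ∀ ω ∈ S, ∀ ω' ∈ S, code m ω = code m ω' → ω = ω' := by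
    rw [Filter.eventually_all_finset]
    intro ω _
    rw [Filter.eventually_all_finset]
    exact fun ω' _ => h ω ω'
  filter_upwards [h2] with m hm ω hω ω' hω' he
  exact hm ω hω ω' hω' he

variable [MeasurableSingletonClass Ω]

/-- Finite configurations are the measures with masses `0` and `1` on all small cells. -/
lemma isFiniteConfig_iff (x : Measure Ω) : IsFiniteConfig x ↔
    ∀ᶠ m in Filter.atTop, ∀ σ : Fin m → Bool, x (code m ⁻¹' {σ}) = 0 ∨ x (code m ⁻¹' {σ}) = 1 := by
  classical
  constructor
  · rintro ⟨S, rfl⟩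
    filter_upwards [eventually_injOn_code S] with m hm σ
    by_cases h : ∃ ω ∈ S, code m ω = σ
    · obtain ⟨ω, hω, rfl⟩ := h
      right
      rw [sum_dirac_cell hm subset_rfl hω, if_pos hω]
    · left
      push Not at h
      exact sum_dirac_cell_eq_zero h
  · intro h
    obtain ⟨m₀, hm₀⟩ := Filter.eventually_atTop.mp h
    have huniv : x Set.univ < ∞ := by
      have : (Set.univ : Set Ω) = ⋃ σ : Fin m₀ → Bool, code m₀ ⁻¹' {σ} := by
        ext ω; simp
      rw [this]
      refine (measure_iUnion_fintype_le x _).trans_lt ?_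
      refine ENNReal.sum_lt_top.mpr fun σ _ => ?_
      rcases hm₀ m₀ le_rfl σ with h0 | h1
      · simp [h0]
      · simp [h1]
    have hfin : IsFiniteMeasure x := ⟨huniv⟩
    -- At each level there are finitely many null cells, so almost every point avoids all of them.
    have hcell : ∀ᵐ ω ∂x, ∀ m, x (code m ⁻¹' {code m ω}) ≠ 0 := by
      rw [ae_all_iff]
      intro m
      have hsub : {ω : Ω | ¬ x (code m ⁻¹' {code m ω}) ≠ 0} ⊆
          ⋃ σ ∈ {σ : Fin m → Bool | x (code m ⁻¹' {σ}) = 0}, code (Ω := Ω) m ⁻¹' {σ} := fun ω hω => by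
        have h0 : x (code m ⁻¹' {code m ω}) = 0 := not_not.mp hω
        exact Set.mem_biUnion (t := fun σ : Fin m → Bool => code (Ω := Ω) m ⁻¹' {σ}) h0 rfl
      rw [ae_iff]
      refine measure_mono_null hsub ?_
      rw [measure_biUnion_null_iff (Set.to_countable _)]
      exact fun σ hσ => hσ
    -- The cells around $\omega$ shrink to $\{\omega\}$ and eventually have mass exactly $1$, so
    -- continuity from above applies.
    have hone : ∀ᵐ ω ∂x, x {ω} = 1 := by
      filter_upwards [hcell] with ω hω
      have hI : ({ω} : Set Ω) = ⋂ m, code m ⁻¹' {code m ω} := by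
        ext ω'
        simp only [Set.mem_singleton_iff, Set.mem_iInter, Set.mem_preimage]
        exact ⟨fun h m => by rw [h], fun h => eq_of_code_eq h⟩
      have hanti : Antitone fun m => code (Ω := Ω) m ⁻¹' {code m ω} := fun m n hmn ω' hω' =>
        code_eq_of_le hmn hω'
      have ht := tendsto_measure_iInter_atTop (μ := x)
        (fun m => (measurableSet_cell m (code m ω)).nullMeasurableSet) hanti
        ⟨0, measure_ne_top _ _⟩
      rw [← hI] at ht
      refine tendsto_nhds_unique ht (tendsto_const_nhds.congr' ?_)
      filter_upwards [Filter.eventually_ge_atTop m₀] with m hm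
      exact ((hm₀ m hm _).resolve_left (hω m)).symm
    set A : Set Ω := {ω | x {ω} = 1} with hA
    -- Each point of $A$ has mass $1$ while the total mass is finite.
    have hAfin : A.Finite := by
      by_contra hinf
      obtain ⟨n, hn⟩ := ENNReal.exists_nat_gt huniv.ne
      obtain ⟨B, hBA, hB⟩ := Set.Infinite.exists_subset_card_eq hinf n
      have h1 : x (B : Set Ω) = n := by
        rw [← sum_measure_singleton, Finset.sum_congr rfl fun ω hω => hBA hω]
        simp [hB]
      exact absurd (measure_mono (μ := x) (Set.subset_univ (B : Set Ω))) (by rw [h1]; exact not_le.mpr hn)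
    refine ⟨hAfin.toFinset, ?_⟩
    ext D hD
    have hae : x D = x (D ∩ A) := by
      refine measure_congr ?_
      filter_upwards [hone] with ω hω
      refine propext ⟨fun h => ⟨h, hω⟩, fun h => h.1⟩
    have hDA : D ∩ A = ((hAfin.toFinset.filter (· ∈ D) : Finset Ω) : Set Ω) := by
      ext ω; simp [and_comm]
    rw [hae, hDA, ← sum_measure_singleton, Finset.sum_filter, Measure.coe_finsetSum,
      Finset.sum_apply]
    refine Finset.sum_congr rfl fun ω hω => ?_
    rw [Measure.dirac_apply' _ hD, Set.indicator_apply]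
    refine if_congr Iff.rfl ?_ rfl
    exact hAfin.mem_toFinset.mp hω

lemma measurableSet_finiteConfig (p : ℕ) :
    MeasurableSet {x : Fin p → Measure Ω | ∀ j, IsFiniteConfig (x j)} := by
  simp only [isFiniteConfig_iff, Filter.eventually_atTop]
  have hm : ∀ (j : Fin p) (m : ℕ) (σ : Fin m → Bool),
      Measurable fun x : Fin p → Measure Ω => x j (code m ⁻¹' {σ}) := fun j m σ =>
    (Measure.measurable_coe (measurableSet_cell m σ)).comp (measurable_pi_apply j)
  have hS : ∀ (j : Fin p) (m : ℕ) (σ : Fin m → Bool), MeasurableSet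
      {x : Fin p → Measure Ω | x j (code m ⁻¹' {σ}) = 0 ∨ x j (code m ⁻¹' {σ}) = 1} := fun j m σ =>
    (hm j m σ (measurableSet_singleton 0)).union (hm j m σ (measurableSet_singleton 1))
  simp only [Set.ofPred_forall, Set.ofPred_exists]
  exact .iInter fun j => .iUnion fun m₀ => .iInter fun m => .iInter fun _ => .iInter fun σ => hS j m σ

/-- Once the cells separate the finitely many atoms of all rows, the cell of an atom carries the
same column as the atom, so coding is a bijection between the points and the cells being counted. -/
lemma eventually_cellCount_eq {p : ℕ} {x : Fin p → Measure Ω} (hx : ∀ j, IsFiniteConfig (x j))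
    (u : NonzeroCol p) :
    ∀ᶠ m in Filter.atTop, (cellCount m x u : ℕ∞) = atomCount x u := by
  classical
  choose S hS using hx
  set R : Finset Ω := Finset.univ.biUnion S with hR
  have hSR : ∀ j, S j ⊆ R := fun j => Finset.subset_biUnion_of_mem S (Finset.mem_univ j)
  -- As $u\ne0$, every point or cell being counted contains an atom of row $j_0$; this confines the
  -- count to the finite set $R$.
  obtain ⟨j₀, hj₀⟩ : ∃ j, u.1 j = true := by
    by_contra! h
    exact u.2 (funext fun j => by simpa using h j)
  have hDR : {ω : Ω | ∀ j, x j {ω} = if u.1 j = true then 1 else 0} ⊆ (R : Set Ω) := fun ω hω => by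
    have h1 := hω j₀
    rw [if_pos hj₀, hS, sum_dirac_singleton] at h1
    by_contra hn
    rw [if_neg fun h => hn (hSR j₀ h)] at h1
    exact zero_ne_one h1
  filter_upwards [eventually_injOn_code R] with m hm
  have himg : ((Finset.univ.filter fun σ : Fin m → Bool =>
      ∀ j, x j (code m ⁻¹' {σ}) = if u.1 j = true then 1 else 0 : Finset _) : Set (Fin m → Bool)) =
      code m '' {ω : Ω | ∀ j, x j {ω} = if u.1 j = true then 1 else 0} := by
    have hxe : ∀ ω ∈ R, ∀ j, x j (code m ⁻¹' {code m ω}) = x j {ω} := fun ω hω j => by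
      rw [hS j, sum_dirac_cell hm (hSR j) hω, sum_dirac_singleton]
    ext σ
    simp only [Finset.coe_filter, Finset.mem_univ, true_and, Set.mem_ofPred_eq, Set.mem_image]
    constructor
    · intro h
      have h1 : ∃ ω ∈ S j₀, code m ω = σ := by
        by_contra! hn
        have h2 := h j₀
        rw [if_pos hj₀, hS, sum_dirac_cell_eq_zero hn] at h2
        exact zero_ne_one h2
      obtain ⟨ω, hω, rfl⟩ := h1
      exact ⟨ω, fun j => by rw [← hxe ω (hSR j₀ hω), h j], rfl⟩
    · rintro ⟨ω, hω, rfl⟩ j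
      rw [hxe ω (hDR hω), hω j]
  rw [cellCount, ← Set.encard_coe_eq_coe_finsetCard, himg, (hm.mono hDR).encard_image, atomCount]

/-- The set of finite configurations with given numbers of columns. -/
lemma measurableSet_finiteConfig_atomCount {p : ℕ} (n : NonzeroCol p → ℕ) :
    MeasurableSet {x : Fin p → Measure Ω |
      (∀ j, IsFiniteConfig (x j)) ∧ ∀ u, atomCount x u = n u} := by
  have h : {x : Fin p → Measure Ω | (∀ j, IsFiniteConfig (x j)) ∧ ∀ u, atomCount x u = n u} =
      {x | ∀ j, IsFiniteConfig (x j)} ∩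
        {x | ∀ u, ∃ m₀, ∀ m, m₀ ≤ m → cellCount m x u = n u} := by
    ext x
    refine and_congr_right fun hx => forall_congr' fun u => ?_
    have he := eventually_cellCount_eq hx u
    rw [← Filter.eventually_atTop]
    constructor
    · intro h
      filter_upwards [he] with m hm
      rw [h] at hm
      exact_mod_cast hm
    · intro h
      obtain ⟨m, hm1, hm2⟩ := (he.and h).exists
      rw [← hm1, hm2]
  rw [h]
  refine (measurableSet_finiteConfig p).inter ?_
  simp only [Set.ofPred_forall, Set.ofPred_exists]
  exact .iInter fun u => .iUnion fun m₀ => .iInter fun m => .iInter fun _ =>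
    measurable_cellCount m u (measurableSet_singleton _)

end

section Rows

variable {Ω : Type*} [MeasurableSpace Ω] {p K : ℕ} {u : Fin K → NonzeroCol p} {ω : Fin K → Ω}

lemma isFiniteConfig_rowsOf (hω : Function.Injective ω) (j : Fin p) :
    IsFiniteConfig (rowsOf u ω j) := by
  classical
  refine ⟨(Finset.univ.filter fun k => (u k).1 j = true).image ω, ?_⟩
  rw [Finset.sum_image fun k _ l _ h => hω h, Finset.sum_filter]
  rfl

variable [MeasurableSingletonClass Ω]

lemma rowsOf_singleton (hω : Function.Injective ω) (j : Fin p) (k : Fin K) :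
    rowsOf u ω j {ω k} = if (u k).1 j = true then 1 else 0 := by
  rw [rowsOf, Measure.coe_finsetSum, Finset.sum_apply, Finset.sum_eq_single k]
  · split_ifs <;> simp
  · intro l _ hl
    have : ω l ≠ ω k := fun h => hl (hω h)
    split_ifs <;> simp [this]
  · simp

open Classical in
lemma atomCount_rowsOf (hω : Function.Injective ω) (v : NonzeroCol p) :
    atomCount (rowsOf u ω) v = ((Finset.univ.filter fun k => u k = v).card : ℕ) := by
  obtain ⟨j₀, hj₀⟩ : ∃ j, v.1 j = true := by
    by_contra! h
    exact v.2 (funext fun j => by simpa using h j)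
  have himg : {ω' : Ω | ∀ j, rowsOf u ω j {ω'} = if v.1 j = true then 1 else 0} =
      ω '' ((Finset.univ.filter fun k => u k = v : Finset _) : Set (Fin K)) := by
    ext ω'
    simp only [Set.mem_ofPred_eq, Set.mem_image, Finset.coe_filter, Finset.mem_univ, true_and]
    constructor
    · intro h
      have h1 : ∃ k, ω k = ω' := by
        by_contra! hn
        have h2 := h j₀
        rw [if_pos hj₀, rowsOf, Measure.coe_finsetSum, Finset.sum_apply, Finset.sum_eq_zero] at h2
        · exact zero_ne_one h2
        · intro k _
          split_ifs <;> simp [hn k]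
      obtain ⟨k, rfl⟩ := h1
      refine ⟨k, Subtype.ext (funext fun j => ?_), rfl⟩
      have h2 := h j
      rw [rowsOf_singleton hω] at h2
      cases h3 : (u k).1 j <;> cases h4 : v.1 j <;> simp_all
    · rintro ⟨k, rfl, rfl⟩ j
      exact rowsOf_singleton hω j k
  rw [atomCount, himg, hω.encard_image, Set.encard_coe_eq_coe_finsetCard]

end Rows

/-! ### Laws of column counts and their generating functions -/

/-- Finite measures on `ℕ^V` are determined by their probability generating functions. -/
theorem ext_of_pgf {V : Type*} [Fintype V] {ρ₁ ρ₂ : Measure (V → ℕ)}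
    [IsFiniteMeasure ρ₁] [IsFiniteMeasure ρ₂]
    (h : ∀ s : V → ℝ, (∀ v, 0 ≤ s v) →
      ∫⁻ n, ∏ v, ENNReal.ofReal (s v) ^ n v ∂ρ₁ = ∫⁻ n, ∏ v, ENNReal.ofReal (s v) ^ n v ∂ρ₂) :
    ρ₁ = ρ₂ := by
  classical
  refine ext_of_laplace (T := V) (fun v n => (n v : ℝ≥0∞)) ?_ fun I k => ?_
  · simp only [MeasurableSpace.pi, MeasurableSpace.comap_iSup, MeasurableSpace.comap_comp]
    refine iSup_congr fun v => ?_
    have hcast : (inferInstance : MeasurableSpace ℕ) =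
        MeasurableSpace.comap (Nat.cast : ℕ → ℝ≥0∞) inferInstance :=
      (MeasurableEmbedding.natCast (α := ℝ≥0∞)).comap_eq.symm
    change MeasurableSpace.comap (fun n : V → ℕ => n v) inferInstance =
      MeasurableSpace.comap ((Nat.cast : ℕ → ℝ≥0∞) ∘ fun n : V → ℕ => n v) inferInstance
    rw [hcast, MeasurableSpace.comap_comp]
  -- The substitution $s_v=e^{-k_v}$ turns the generating function into a Laplace transform;
  -- coordinates outside $I$ get $s_v=1$.
  · have hk : ∀ n : V → ℕ, expNeg (∑ t ∈ I, k t * (n t : ℝ≥0∞)) =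
        ∏ v, ENNReal.ofReal (if v ∈ I then (expNeg (k v)).toReal else 1) ^ n v := fun n => by
      rw [expNeg_sum, ← Finset.prod_subset (Finset.subset_univ I) fun v _ hv => by simp [hv]]
      refine Finset.prod_congr rfl fun v hv => ?_
      rw [if_pos hv, ENNReal.ofReal_toReal (expNeg_ne_top _), mul_comm, expNeg_nat_mul]
    simp_rw [hk]
    refine h _ fun v => ?_
    split_ifs
    · exact ENNReal.toReal_nonneg
    · exact zero_le_one

lemma measurable_pgf {V : Type*} [Fintype V] (s : V → ℝ) :
    Measurable fun n : V → ℕ => ∏ v, ENNReal.ofReal (s v) ^ n v :=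
  Finset.measurable_prod _ fun v _ =>
    (measurable_of_countable fun n : ℕ => ENNReal.ofReal (s v) ^ n).comp (measurable_pi_apply v)

/-- Extension of a function on nonzero columns by the value `1`. -/
def extendOne {p : ℕ} (s : NonzeroCol p → ℝ) (u : Fin p → Bool) : ℝ :=
  if h : u ≠ fun _ => false then s ⟨u, h⟩ else 1

section

variable {p : ℕ} {s : NonzeroCol p → ℝ}

lemma extendOne_coe (v : NonzeroCol p) : extendOne s v.1 = s v := by
  rw [extendOne, dif_pos v.2]

lemma extendOne_false : extendOne s (fun _ => false) = 1 := by
  simp [extendOne]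

lemma extendOne_nonneg (hs : ∀ v, 0 ≤ s v) (u : Fin p → Bool) : 0 ≤ extendOne s u := by
  rw [extendOne]
  split_ifs
  · exact hs _
  · exact zero_le_one

lemma prod_pow_ite (s : NonzeroCol p → ℝ) (u : Fin p → Bool) :
    ∏ v : NonzeroCol p, ENNReal.ofReal (s v) ^ (if u = v.1 then 1 else 0) =
      ENNReal.ofReal (extendOne s u) := by
  by_cases hu : u ≠ fun _ => false
  · rw [Finset.prod_eq_single (⟨u, hu⟩ : NonzeroCol p)]
    · simp [extendOne, hu]
    · intro v _ hv
      rw [if_neg fun h => hv (Subtype.ext h.symm), pow_zero]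
    · simp
  · rw [Finset.prod_eq_one]
    · simp [extendOne, hu]
    · intro v _
      rw [if_neg fun h : u = v.1 => hu (h.symm ▸ v.2), pow_zero]

lemma prod_pow_card (s : NonzeroCol p → ℝ) {K : ℕ} (M : Fin K → Fin p → Bool) :
    ∏ v : NonzeroCol p, ENNReal.ofReal (s v) ^ (Finset.univ.filter fun k => M k = v.1).card =
      ∏ k, ENNReal.ofReal (extendOne s (M k)) := by
  simp_rw [Finset.card_filter, ← Finset.prod_pow_eq_pow_sum]
  rw [Finset.prod_comm]
  exact Finset.prod_congr rfl fun k _ => prod_pow_ite s (M k)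

lemma prod_pow_count (s : NonzeroCol p → ℝ) (cs : List (Fin p → Bool)) :
    ∏ v : NonzeroCol p, ENNReal.ofReal (s v) ^ cs.count v.1 =
      (cs.map fun u => ENNReal.ofReal (extendOne s u)).prod := by
  induction cs with
  | nil => simp
  | cons u cs ih =>
    rw [List.map_cons, List.prod_cons, ← ih, ← prod_pow_ite, ← Finset.prod_mul_distrib]
    refine Finset.prod_congr rfl fun v _ => ?_
    rw [List.count_cons, pow_add, mul_comm]
    simp

end

/-- The law of the column counts under `cibpLaw`. -/
def countLaw (p : ℕ) (γ α κ : ℝ) : Measure (NonzeroCol p → ℕ) :=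
  Measure.sum fun K : ℕ => (K.factorial : ℝ≥0∞)⁻¹ •
    ∑ u : Fin K → NonzeroCol p,
      (ENNReal.ofReal (Real.exp (-γ * tastedMass p α κ)) *
        ∏ k, ENNReal.ofReal (γ * colWeight α κ (u k).1)) •
        Measure.dirac fun v => (Finset.univ.filter fun k => u k = v).card

/-- The same exponential series as for `cibpLaw`, with $s_u$ in place of $L_u$. As $\sum_{u\ne0}w_u$
equals `tastedMass`, the value is the generating function of independent $\mathrm{Poisson}(\gamma
w_u)$ counts. -/
lemma lintegral_countLaw {p : ℕ} {γ α κ : ℝ} (hγ : 0 < γ) (hα : 0 < α) (hκ : 0 ≤ κ)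
    {s : NonzeroCol p → ℝ} (hs : ∀ v, 0 ≤ s v) :
    ∫⁻ n, ∏ v, ENNReal.ofReal (s v) ^ n v ∂countLaw p γ α κ =
      ENNReal.ofReal (Real.exp (γ * (∑ v, colWeight α κ v.1 * s v - tastedMass p α κ))) := by
  have hw0 : ∀ u : NonzeroCol p, 0 ≤ γ * colWeight α κ u.1 := fun u =>
    mul_nonneg hγ.le (colWeight_pos hα hκ _).le
  rw [countLaw, lintegral_sum_measure]
  have hterm : ∀ K : ℕ, ∫⁻ n, ∏ v, ENNReal.ofReal (s v) ^ n v ∂((K.factorial : ℝ≥0∞)⁻¹ •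
      ∑ u : Fin K → NonzeroCol p,
        (ENNReal.ofReal (Real.exp (-γ * tastedMass p α κ)) *
          ∏ k, ENNReal.ofReal (γ * colWeight α κ (u k).1)) •
          Measure.dirac fun v => (Finset.univ.filter fun k => u k = v).card) =
      ENNReal.ofReal (Real.exp (-γ * tastedMass p α κ)) *
        ((K.factorial : ℝ≥0∞)⁻¹ * ENNReal.ofReal (∑ u, γ * colWeight α κ u.1 * s u) ^ K) :=
      fun K => by
    rw [lintegral_smul_measure, lintegral_finsetSum_measure, smul_eq_mul,
      ENNReal.ofReal_sum_of_nonneg fun u _ => mul_nonneg (hw0 u) (hs u), Fintype.sum_pow,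
      mul_left_comm]
    congr 1
    rw [Finset.mul_sum]
    refine Finset.sum_congr rfl fun u _ => ?_
    have hcard : ∏ v, ENNReal.ofReal (s v) ^ (Finset.univ.filter fun k => u k = v).card =
        ∏ k, ENNReal.ofReal (s (u k)) := by
      have := prod_pow_card s fun k => (u k).1
      simp_rw [extendOne_coe, Subtype.coe_inj] at this
      exact this
    rw [lintegral_smul_measure, lintegral_dirac' _ (measurable_pgf s), smul_eq_mul, hcard, mul_assoc,
      ← Finset.prod_mul_distrib]
    congr 1
    exact Finset.prod_congr rfl fun k _ => (ENNReal.ofReal_mul (hw0 _)).symm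
  simp_rw [hterm]
  rw [ENNReal.tsum_mul_left,
    tsum_inv_factorial_mul_pow (Finset.sum_nonneg fun u _ => mul_nonneg (hw0 u) (hs u)),
    ← ENNReal.ofReal_mul (Real.exp_pos _).le, ← Real.exp_add]
  congr 2
  simp only [mul_assoc]
  rw [← Finset.mul_sum]
  ring

lemma isFiniteMeasure_of_pgf {V : Type*} [Fintype V] {ρ : Measure (V → ℕ)}
    (h : ∫⁻ n, ∏ v : V, ENNReal.ofReal 1 ^ n v ∂ρ ≠ ∞) : IsFiniteMeasure ρ := by
  refine ⟨lt_top_iff_ne_top.mpr ?_⟩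
  simpa using h

/-! ### The hierarchical representation -/

lemma measurable_pi_measure {ι X : Type*} [Fintype ι] {Y : ι → Type*} [MeasurableSpace X]
    [∀ i, MeasurableSpace (Y i)] {m : ∀ i, X → Measure (Y i)}
    [∀ i x, IsProbabilityMeasure (m i x)] (hm : ∀ i, Measurable (m i)) :
    Measurable fun x => Measure.pi fun i => m i x := by
  refine Measurable.measure_of_isPiSystem_of_isProbabilityMeasure generateFrom_pi.symm isPiSystem_pi ?_
  rintro _ ⟨t, ht, rfl⟩
  simp_rw [Measure.pi_pi]
  exact Finset.measurable_prod _ fun i _ =>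
    (Measure.measurable_coe (ht i (Set.mem_univ i))).comp (hm i)

lemma measurable_bern : Measurable bern := by
  have h : ∀ r, bern r = ENNReal.ofReal (max 0 (min 1 r)) • Measure.dirac true +
      ENNReal.ofReal (1 - max 0 (min 1 r)) • Measure.dirac false := fun r => by
    have h0 : 0 ≤ max 0 (min 1 r) := le_max_left _ _
    have h1 : max 0 (min 1 r) ≤ 1 := max_le zero_le_one (min_le_left _ _)
    rw [bern, bernoulliMeasure_def]
    congr 1
    · change _ = Real.toNNReal _ • Measure.dirac true
      rw [Real.toNNReal_of_nonneg h0]; rfl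
    · change _ = Real.toNNReal _ • Measure.dirac false
      rw [Real.toNNReal_of_nonneg (by linarith)]; rfl
  refine Measure.measurable_of_measurable_coe _ fun A _ => ?_
  simp only [h, Measure.coe_add, Measure.coe_smul, Pi.add_apply, Pi.smul_apply, smul_eq_mul]
  fun_prop

lemma lintegral_pi_bern {p : ℕ} {θ : ℝ} (h0 : 0 ≤ θ) (h1 : θ ≤ 1) (g : (Fin p → Bool) → ℝ≥0∞) :
    ∫⁻ u, g u ∂(Measure.pi fun _ : Fin p => bern θ) = ∑ u : Fin p → Bool, g u *
      ∏ j, (if u j = true then ENNReal.ofReal θ else ENNReal.ofReal (1 - θ)) := by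
  rw [lintegral_fintype]
  refine Finset.sum_congr rfl fun u _ => ?_
  rw [Measure.pi_singleton]
  congr 1
  refine Finset.prod_congr rfl fun j _ => ?_
  have h := lintegral_bern h0 h1 (({u j} : Set Bool).indicator 1)
  rw [lintegral_indicator_one (measurableSet_singleton _)] at h
  rw [h]
  cases u j <;> simp

/-- After averaging over its own beta weight, each column is an independent draw with law $w$ and
contributes $\sum_u w_us_u$, where $s_0=1$ because zero columns are not counted. The Poisson
generating function in $K$ finishes. -/
lemma lintegral_hierarchicalLaw {p : ℕ} {γ α κ : ℝ} (hγ : 0 < γ) (hα : 0 < α) (hκ : 0 ≤ κ)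
    {s : NonzeroCol p → ℝ} (hs : ∀ v, 0 ≤ s v) :
    ∫⁻ n, ∏ v, ENNReal.ofReal (s v) ^ n v ∂hierarchicalLaw p γ α κ =
      ENNReal.ofReal (Real.exp (γ * (∑ v, colWeight α κ v.1 * s v - tastedMass p α κ))) := by
  have := isProbabilityMeasureBeta hα (show 0 < κ + 1 by linarith)
  have hkernel : ∀ K : ℕ, Measurable fun θ : Fin K → ℝ =>
      Measure.pi fun k : Fin K => Measure.pi fun _ : Fin p => bern (θ k) := fun K =>
    measurable_pi_measure fun k => measurable_pi_measure fun _ =>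
      measurable_bern.comp (measurable_pi_apply k)
  set g : ℝ → ℝ≥0∞ := fun θ =>
    ∫⁻ u, ENNReal.ofReal (extendOne s u) ∂(Measure.pi fun _ : Fin p => bern θ) with hg
  have hgm : Measurable g := (Measure.measurable_lintegral (measurable_of_countable _)).comp
    (measurable_pi_measure fun _ => measurable_bern)
  have hgint : ∫⁻ θ, g θ ∂betaMeasure α (κ + 1) =
      ENNReal.ofReal (∑ u, colWeight α κ u * extendOne s u) := by
    have h1 : ∀ᵐ θ ∂betaMeasure α (κ + 1), g θ = ∑ u : Fin p → Bool,
        ENNReal.ofReal (extendOne s u) *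
          ∏ j, (if u j = true then ENNReal.ofReal θ else ENNReal.ofReal (1 - θ)) := by
      filter_upwards [ae_betaMeasure α (κ + 1)] with θ hθ
      exact lintegral_pi_bern hθ.1.le hθ.2.le _
    have hm : ∀ u : Fin p → Bool, Measurable fun θ : ℝ =>
        ∏ j, (if u j = true then ENNReal.ofReal θ else ENNReal.ofReal (1 - θ)) := fun u =>
      Finset.measurable_prod _ fun j _ => by split_ifs <;> fun_prop
    rw [lintegral_congr_ae h1, lintegral_finsetSum _ fun u _ => (hm u).const_mul _,
      ENNReal.ofReal_sum_of_nonneg fun u _ =>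
        mul_nonneg (colWeight_pos hα hκ u).le (extendOne_nonneg hs u)]
    refine Finset.sum_congr rfl fun u _ => ?_
    rw [lintegral_const_mul _ (hm u), lintegral_colWeight hα hκ, mul_comm,
      ENNReal.ofReal_mul (colWeight_pos hα hκ u).le]
  rw [hierarchicalLaw, Measure.lintegral_bind (measurable_of_countable _).aemeasurable
    (measurable_pgf s).aemeasurable]
  have hK : ∀ K : ℕ, ∫⁻ n, ∏ v, ENNReal.ofReal (s v) ^ n v
      ∂((Measure.pi fun _ : Fin K => betaMeasure α (κ + 1)).bind fun θ =>
        Measure.pi fun k : Fin K => Measure.pi fun _ : Fin p => bern (θ k)).map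
        (fun (M : Fin K → Fin p → Bool) (u : NonzeroCol p) =>
          (Finset.univ.filter fun k => M k = u.1).card) =
      ENNReal.ofReal (∑ u, colWeight α κ u * extendOne s u) ^ K := fun K => by
    rw [lintegral_map (measurable_pgf s) (measurable_of_countable _)]
    simp_rw [prod_pow_card]
    rw [Measure.lintegral_bind (hkernel K).aemeasurable (measurable_of_countable _).aemeasurable]
    have hin : ∀ θ : Fin K → ℝ, ∫⁻ M : Fin K → Fin p → Bool,
        ∏ k, ENNReal.ofReal (extendOne s (M k))
        ∂(Measure.pi fun k : Fin K => Measure.pi fun _ : Fin p => bern (θ k)) = ∏ k, g (θ k) :=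
      fun θ => by
        rw [lintegral_pi_prod (fun k : Fin K => Measure.pi fun _ : Fin p => bern (θ k))
          (f := fun _ u => ENNReal.ofReal (extendOne s u)) fun _ => measurable_of_countable _]
    simp_rw [hin]
    rw [lintegral_pi_prod _ fun _ => hgm, Finset.prod_const, hgint, Finset.card_univ,
      Fintype.card_fin]
  simp_rw [hK]
  rw [lintegral_poissonMeasure, tsum_poisson_mul_pow _ (Finset.sum_nonneg fun u _ =>
    mul_nonneg (colWeight_pos hα hκ u).le (extendOne_nonneg hs u)), Real.coe_toNNReal _ hγ.le,
    sum_nonzeroCol, extendOne_false]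
  simp_rw [extendOne_coe]
  congr 2
  -- The zero column leaves $w_0-1$ in the exponent, which is minus `tastedMass`.
  linear_combination γ * colWeight_false_add hα hκ p

theorem countLaw_eq_hierarchicalLaw {p : ℕ} {γ α κ : ℝ} (hγ : 0 < γ) (hα : 0 < α) (hκ : 0 ≤ κ) :
    countLaw p γ α κ = hierarchicalLaw p γ α κ := by
  have h1 : IsFiniteMeasure (countLaw p γ α κ) := isFiniteMeasure_of_pgf (by
    rw [lintegral_countLaw (s := fun _ => 1) hγ hα hκ fun _ => zero_le_one]
    exact ENNReal.ofReal_ne_top)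
  have h2 : IsFiniteMeasure (hierarchicalLaw p γ α κ) := isFiniteMeasure_of_pgf (by
    rw [lintegral_hierarchicalLaw (s := fun _ => 1) hγ hα hκ fun _ => zero_le_one]
    exact ENNReal.ofReal_ne_top)
  refine ext_of_pgf fun s hs => ?_
  rw [lintegral_countLaw hγ hα hκ hs, lintegral_hierarchicalLaw hγ hα hκ hs]

/-! ### The restaurant representation -/

/-- The expectation of a nonnegative function under a discrete law. -/
def pmfExp {X : Type*} (q : PMF X) (g : X → ℝ≥0∞) : ℝ≥0∞ := ∑' x, q x * g x

lemma pmfExp_pure {X : Type*} (a : X) (g : X → ℝ≥0∞) : pmfExp (PMF.pure a) g = g a := by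
  classical
  rw [pmfExp, tsum_eq_single a fun b hb => by simp [PMF.pure_apply, hb]]
  simp

/-- Tower property. It treats the restaurant by iterated sums, with no $\sigma$-algebra on lists. -/
lemma pmfExp_bind {X Y : Type*} (q : PMF X) (k : X → PMF Y) (g : Y → ℝ≥0∞) :
    pmfExp (q.bind k) g = pmfExp q fun x => pmfExp (k x) g := by
  simp only [pmfExp, PMF.bind_apply, ← ENNReal.tsum_mul_right, ← ENNReal.tsum_mul_left]
  rw [ENNReal.tsum_comm]
  simp only [mul_assoc]

lemma pmfExp_mul_const {X : Type*} (q : PMF X) (g : X → ℝ≥0∞) (a : ℝ≥0∞) :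
    pmfExp q (fun x => g x * a) = pmfExp q g * a := by
  simp only [pmfExp, ← mul_assoc, ENNReal.tsum_mul_right]

lemma pmfExp_const_mul {X : Type*} (q : PMF X) (g : X → ℝ≥0∞) (a : ℝ≥0∞) :
    pmfExp q (fun x => a * g x) = a * pmfExp q g := by
  simp_rw [mul_comm a, pmfExp_mul_const]

lemma pmfExp_toPMF {X : Type*} [Countable X] [MeasurableSpace X] [MeasurableSingletonClass X]
    (ρ : Measure X) [IsProbabilityMeasure ρ] (g : X → ℝ≥0∞) :
    pmfExp ρ.toPMF g = ∫⁻ x, g x ∂ρ := by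
  rw [lintegral_countable', pmfExp]
  exact tsum_congr fun x => mul_comm _ _

/-- The retrial probability of a dish. -/
def retryProb {j : ℕ} (α κ : ℝ) (c : Fin j → Bool) : ℝ :=
  (numOnes c + α) / (((j + 1 : ℕ) : ℝ) + κ + α)

/-- The one-step average of a function of columns over the retrial of a dish. -/
def retryMean {j : ℕ} (α κ : ℝ) (h : (Fin (j + 1) → Bool) → ℝ) (c : Fin j → Bool) : ℝ :=
  retryProb α κ c * h (Fin.snoc c true) + (1 - retryProb α κ c) * h (Fin.snoc c false)

section

variable {α κ : ℝ} {j : ℕ}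

lemma retryProb_nonneg (hα : 0 < α) (hκ : 0 ≤ κ) (c : Fin j → Bool) : 0 ≤ retryProb α κ c := by
  rw [retryProb]; positivity

lemma retryProb_le_one (hα : 0 < α) (hκ : 0 ≤ κ) (c : Fin j → Bool) : retryProb α κ c ≤ 1 := by
  have h : (numOnes c : ℝ) ≤ j := by exact_mod_cast numOnes_le c
  rw [retryProb, div_le_one (by positivity)]
  push_cast
  linarith

lemma retryMean_nonneg (hα : 0 < α) (hκ : 0 ≤ κ) {h : (Fin (j + 1) → Bool) → ℝ}
    (hh : ∀ c, 0 ≤ h c) (c : Fin j → Bool) : 0 ≤ retryMean α κ h c :=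
  add_nonneg (mul_nonneg (retryProb_nonneg hα hκ c) (hh _))
    (mul_nonneg (sub_nonneg.mpr (retryProb_le_one hα hκ c)) (hh _))

/-- Dishes are retried independently, so multiplicative functionals stay multiplicative: one
customer replaces $h$ by its one-step mean. -/
lemma pmfExp_tryOldDishes (hα : 0 < α) (hκ : 0 ≤ κ) {h : (Fin (j + 1) → Bool) → ℝ}
    (hh : ∀ c, 0 ≤ h c) (cs : List (Fin j → Bool)) :
    pmfExp (tryOldDishes α κ j cs) (fun cs' => (cs'.map fun c => ENNReal.ofReal (h c)).prod) =
      (cs.map fun c => ENNReal.ofReal (retryMean α κ h c)).prod := by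
  induction cs with
  | nil => simp [tryOldDishes, pmfExp_pure]
  | cons c cs ih =>
    have h0 := retryProb_nonneg hα hκ c
    have h1 := retryProb_le_one hα hκ c
    rw [tryOldDishes, pmfExp_bind]
    simp_rw [pmfExp_bind, pmfExp_pure, List.map_cons, List.prod_cons, pmfExp_const_mul, ih]
    rw [pmfExp_mul_const, pmfExp_toPMF]
    congr 1
    rw [← retryProb, lintegral_bern h0 h1, retryMean, ENNReal.ofReal_add (mul_nonneg h0 (hh _))
      (mul_nonneg (sub_nonneg.mpr h1) (hh _)), ENNReal.ofReal_mul h0,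
      ENNReal.ofReal_mul (sub_nonneg.mpr h1)]

/-- A nonzero column of length $j+1$ either extends a nonzero column, where the predictive
probabilities assemble the one-step mean, or is the column $(0,\dots,0,1)$ of a new dish. -/
lemma sum_nonzeroCol_snoc (hα : 0 < α) (hκ : 0 ≤ κ) (h : (Fin (j + 1) → Bool) → ℝ) :
    ∑ v : NonzeroCol (j + 1), colWeight α κ v.1 * (h v.1 - 1) =
      ∑ u : NonzeroCol j, colWeight α κ u.1 * (retryMean α κ h u.1 - 1) +
        colWeight α κ (Fin.snoc (fun _ => false) true : Fin (j + 1) → Bool) *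
          (h (Fin.snoc (fun _ => false) true) - 1) := by
  have h1 := sum_nonzeroCol fun v : Fin (j + 1) → Bool => colWeight α κ v * (h v - 1)
  have h2 := sum_nonzeroCol fun u : Fin j → Bool =>
    colWeight α κ (Fin.snoc u true : Fin (j + 1) → Bool) * (h (Fin.snoc u true) - 1) +
      colWeight α κ (Fin.snoc u false : Fin (j + 1) → Bool) * (h (Fin.snoc u false) - 1)
  have h3 : (Fin.snoc (fun _ : Fin j => false) false : Fin (j + 1) → Bool) = fun _ => false := by
    funext i
    refine Fin.lastCases ?_ (fun i => ?_) i <;> simp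
  have h4 : ∑ u : NonzeroCol j, colWeight α κ u.1 * (retryMean α κ h u.1 - 1) =
      ∑ u : NonzeroCol j,
        (colWeight α κ (Fin.snoc u.1 true : Fin (j + 1) → Bool) * (h (Fin.snoc u.1 true) - 1) +
        colWeight α κ (Fin.snoc u.1 false : Fin (j + 1) → Bool) * (h (Fin.snoc u.1 false) - 1)) := by
    refine Finset.sum_congr rfl fun u _ => ?_
    rw [colWeight_snoc_true hα hκ, colWeight_snoc_false hα hκ, ← retryProb, retryMean]
    ring
  rw [sum_snoc] at h1
  rw [h2, h3] at h1
  linarith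

end

/-- Induction on customers with $h$ arbitrary, since the step applies the hypothesis to the one-step
mean of $h$. The new dishes contribute the Poisson factor of the column $(0,\dots,0,1)$, and the two
exponents add up by `sum_nonzeroCol_snoc`. -/
lemma pmfExp_restaurant {γ α κ : ℝ} (hγ : 0 < γ) (hα : 0 < α) (hκ : 0 ≤ κ) {j : ℕ}
    {h : (Fin j → Bool) → ℝ} (hh : ∀ c, 0 ≤ h c) :
    pmfExp (restaurant γ α κ j) (fun cs => (cs.map fun c => ENNReal.ofReal (h c)).prod) =
      ENNReal.ofReal (Real.exp (γ * ∑ u : NonzeroCol j, colWeight α κ u.1 * (h u.1 - 1))) := by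
  induction j with
  | zero =>
    have : IsEmpty (NonzeroCol 0) := ⟨fun u => u.2 (Subsingleton.elim _ _)⟩
    simp [restaurant, pmfExp_pure]
  | succ j ih =>
    set d : Fin (j + 1) → Bool := Fin.snoc (fun _ => false) true with hd
    have hrate : γ * beta (α + 1) (κ + ((j + 1 : ℕ) : ℝ)) / beta α (κ + 1) = γ * colWeight α κ d := by
      rw [colWeight, hd, numOnes_snoc, numOnes_false, betaRatio]
      push_cast
      rw [mul_div_assoc]
      congr 3
      · simp
      · simp; ring
    have hd0 : 0 ≤ γ * colWeight α κ d := mul_nonneg hγ.le (colWeight_pos hα hκ d).le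
    rw [restaurant, pmfExp_bind]
    simp_rw [pmfExp_bind, pmfExp_pure, List.map_append, List.prod_append, List.map_replicate,
      List.prod_replicate, pmfExp_const_mul, pmfExp_mul_const, pmfExp_tryOldDishes hα hκ hh]
    rw [ih fun c => retryMean_nonneg hα hκ hh c, pmfExp_toPMF,
      lintegral_poissonMeasure, tsum_poisson_mul_pow _ (hh _), hrate, Real.coe_toNNReal _ hd0,
      ← ENNReal.ofReal_mul (Real.exp_pos _).le, ← Real.exp_add, sum_nonzeroCol_snoc hα hκ]
    congr 2
    ring

theorem countLaw_singleton_eq_restaurantLaw {p : ℕ} {γ α κ : ℝ} (hγ : 0 < γ) (hα : 0 < α)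
    (hκ : 0 ≤ κ) (n : NonzeroCol p → ℕ) : countLaw p γ α κ {n} = restaurantLaw p γ α κ n := by
  have h1 : IsFiniteMeasure (countLaw p γ α κ) := isFiniteMeasure_of_pgf (by
    rw [lintegral_countLaw (s := fun _ => 1) hγ hα hκ fun _ => zero_le_one]
    exact ENNReal.ofReal_ne_top)
  have h : countLaw p γ α κ = (restaurantLaw p γ α κ).toMeasure := by
    refine ext_of_pgf fun s hs => ?_
    rw [lintegral_countLaw hγ hα hκ hs, lintegral_countable']
    have h2 : ∀ m, (∏ v, ENNReal.ofReal (s v) ^ m v) * (restaurantLaw p γ α κ).toMeasure {m} =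
        restaurantLaw p γ α κ m * ∏ v, ENNReal.ofReal (s v) ^ m v := fun m => by
      rw [PMF.toMeasure_apply_singleton _ _ (measurableSet_singleton m), mul_comm]
    simp_rw [h2]
    change _ = pmfExp _ _
    rw [restaurantLaw, ← PMF.bind_pure_comp, pmfExp_bind]
    simp only [Function.comp_apply, pmfExp_pure, prod_pow_count]
    rw [pmfExp_restaurant hγ hα hκ (extendOne_nonneg hs)]
    simp only [extendOne_coe, mul_sub_one, Finset.sum_sub_distrib, sum_nonzeroCol_colWeight hα hκ]
  rw [h, PMF.toMeasure_apply_singleton _ _ (measurableSet_singleton n)]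

/-! ### Column counts of the random measures -/

section

variable {Ω : Type*} [MeasurableSpace Ω] [MeasurableSpace.CountablyGenerated Ω]
  [MeasurableSpace.SeparatesPoints Ω] [MeasurableSingletonClass Ω] [MeasurableEq Ω]

lemma ae_isFiniteConfig_cibpLaw {p : ℕ} {γ α κ : ℝ} {ν : Measure Ω}
    [SigmaFinite ν] {lam0 : Ω → ℝ≥0∞} (hlam0 : Measurable lam0) {Λ₀ : Measure Ω}
    [IsProbabilityMeasure Λ₀] [NullSingletonClass Λ₀] (hΛ₀ : Λ₀ = ν.withDensity lam0) :
    ∀ᵐ x ∂cibpLaw p γ α κ ν lam0, ∀ j, IsFiniteConfig (x j) := by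
  have hinst : NullSingletonClass (Λ₀.map id) := by rw [Measure.map_id]; infer_instance
  rw [cibpLaw_eq hlam0 hΛ₀, Measure.ae_sum_iff' (measurableSet_finiteConfig p)]
  intro K
  refine Measure.ae_smul_measure ?_ _
  rw [← Measure.sum_fintype, Measure.ae_sum_iff' (measurableSet_finiteConfig p)]
  intro u
  refine Measure.ae_smul_measure ?_ _
  rw [ae_map_iff (measurable_rowsOf u).aemeasurable (measurableSet_finiteConfig p)]
  filter_upwards [ae_pi_injective Λ₀ measurable_id K] with ω hω
  exact isFiniteConfig_rowsOf hω

/-- For fixed $K$ and columns, the counts are deterministic as soon as the positions are distinct,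
so each component gives the event mass $0$ or $1$, exactly as the Dirac mass in `countLaw` does. -/
lemma cibpLaw_atomCount {p : ℕ} {γ α κ : ℝ} {ν : Measure Ω}
    [SigmaFinite ν] {lam0 : Ω → ℝ≥0∞} (hlam0 : Measurable lam0) {Λ₀ : Measure Ω}
    [IsProbabilityMeasure Λ₀] [NullSingletonClass Λ₀] (hΛ₀ : Λ₀ = ν.withDensity lam0)
    (n : NonzeroCol p → ℕ) :
    cibpLaw p γ α κ ν lam0 {x | (∀ j, IsFiniteConfig (x j)) ∧ ∀ u, atomCount x u = n u} =
      countLaw p γ α κ {n} := by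
  have hinst : NullSingletonClass (Λ₀.map id) := by rw [Measure.map_id]; infer_instance
  have hA := measurableSet_finiteConfig_atomCount (Ω := Ω) n
  rw [cibpLaw_eq hlam0 hΛ₀, countLaw, Measure.sum_apply _ hA,
    Measure.sum_apply _ (measurableSet_singleton n)]
  refine tsum_congr fun K => ?_
  rw [Measure.smul_apply, Measure.smul_apply, Measure.coe_finsetSum, Measure.coe_finsetSum,
    Finset.sum_apply, Finset.sum_apply]
  congr 1
  refine Finset.sum_congr rfl fun u _ => ?_
  rw [Measure.smul_apply, Measure.smul_apply, Measure.map_apply (measurable_rowsOf u) hA,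
    Measure.dirac_apply]
  congr 1
  have hinj : ∀ᵐ ω ∂(Measure.pi fun _ : Fin K => Λ₀), Function.Injective ω :=
    ae_pi_injective Λ₀ measurable_id K
  by_cases h : (fun v => (Finset.univ.filter fun k => u k = v).card) = n
  · rw [Set.indicator_of_mem (by exact h)]
    refine (prob_compl_eq_zero_iff (measurable_rowsOf u hA)).mp ?_
    rw [← mem_ae_iff]
    filter_upwards [hinj] with ω hω
    refine ⟨isFiniteConfig_rowsOf hω, fun v => ?_⟩
    rw [atomCount_rowsOf hω, ← congrFun h v]
  · rw [Set.indicator_of_notMem (by exact h)]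
    rw [← compl_compl (rowsOf u ⁻¹' _), ← mem_ae_iff]
    filter_upwards [hinj] with ω hω hmem
    refine h (funext fun v => ?_)
    have h1 := hmem.2 v
    rw [atomCount_rowsOf hω] at h1
    convert ENat.natCast_inj.mp h1

end

end CIBP

end

/-! ### The main theorem -/

theorem mainTheorem4 {Ω S : Type*} [TopologicalSpace Ω] [PolishSpace Ω] [MeasurableSpace Ω]
    [BorelSpace Ω] [MeasurableSpace S] (P : Measure S) [IsProbabilityMeasure P]
    (γ α κ : ℝ) (hγ : 0 < γ) (hα : 0 < α) (hκ : 0 ≤ κ)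
    (ν : Measure Ω) [SigmaFinite ν] (lam0 : Ω → ℝ≥0∞) (hlam0 : Measurable lam0)
    (Λ₀ : Measure Ω) [IsProbabilityMeasure Λ₀] [NullSingletonClass Λ₀] (hΛ₀ : Λ₀ = ν.withDensity lam0)
    (p : ℕ) (μ : S → Measure Ω) (ξ : Fin p → S → Measure Ω)
    (hμ : CIBP.IsCRM P μ (CIBP.levyIntensity γ α κ Λ₀))
    (hξ : CIBP.IsCondIIDBernoulli P ξ μ) :
    P.map (fun s j => ξ j s) = CIBP.cibpLaw p γ α κ ν lam0 ∧
    ∀ n : CIBP.NonzeroCol p → ℕ,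
      P {s | ∀ u, CIBP.atomCount (fun j => ξ j s) u = n u} = CIBP.hierarchicalLaw p γ α κ {n} ∧
      P {s | ∀ u, CIBP.atomCount (fun j => ξ j s) u = n u} = CIBP.restaurantLaw p γ α κ n := by
  have hlaw := CIBP.map_rows_eq_cibpLaw hγ hα hκ hlam0 hΛ₀ hμ hξ
  have hmeas : Measurable fun s j => ξ j s := measurable_pi_lambda _ hξ.1
  have hfin : ∀ᵐ s ∂P, ∀ j, CIBP.IsFiniteConfig (ξ j s) := by
    have h := CIBP.ae_isFiniteConfig_cibpLaw (p := p) (γ := γ) (α := α) (κ := κ) hlam0 hΛ₀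
    rw [← hlaw] at h
    exact ae_of_ae_map hmeas.aemeasurable h
  have hcount : ∀ n : CIBP.NonzeroCol p → ℕ,
      P {s | ∀ u, CIBP.atomCount (fun j => ξ j s) u = n u} = CIBP.countLaw p γ α κ {n} := fun n => by
    rw [← CIBP.cibpLaw_atomCount hlam0 hΛ₀ n, ← hlaw,
      Measure.map_apply hmeas (CIBP.measurableSet_finiteConfig_atomCount n)]
    -- Measurability of the count event was obtained only within finite configurations; almost
    -- surely all rows are of this kind, so the two events have the same probability.
    refine measure_congr ?_
    filter_upwards [hfin] with s hs
    exact propext ⟨fun h => ⟨hs, h⟩, fun h => h.2⟩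
  refine ⟨hlaw, fun n => ⟨?_, ?_⟩⟩
  · rw [hcount, CIBP.countLaw_eq_hierarchicalLaw hγ hα hκ]
  · rw [hcount, CIBP.countLaw_singleton_eq_restaurantLaw hγ hα hκ]
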